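/- Let $N\ge 0$, $T>0$, and let $v:\mathbb{R}^N\to\mathbb{R}$ be Lipschitz continuous (possibly unbounded and of changing sign) and $u_T:\mathbb{R}^N\to\mathbb{R}$ bounded and Lipschitz continuous. For $\varepsilon>0$ put $C_\varepsilon(r)=\min(\max(r,\varepsilon^{3/2}),\varepsilon^{1/2})$, let $B_\varepsilon(x)$ be the open ball, $v_\pm=\max(\pm v,0)$, and set $$E^\pm(x)=\begin{cases}B_\varepsilon(x)\cap\{\pm v>0\}&\text{if this set is nonempty},\\ \{x\}&\text{otherwise,}\end{cases}\qquad \tau^\pm(x,y)=\begin{cases}C_\varepsilon(\varepsilon/v_\pm(y))&\text{if }B_\varepsilon(x)\cap\{\pm v>0\}\neq\varnothing,\\ \varepsilon^2&\text{otherwise.}\end{cases}$$ Consider the game in which, starting from $(t,x)$ with $t<T$, Paul chooses $x_P\in E^+(x)$, then Carol chooses $x_C\in E^-(x_P)$, the game is moved to the point $x_C$ and the time $t_C=t+\tau^+(x,x_P)+\tau^-(x_P,x_C)$, and these steps are repeated until $t_C\ge T$, when Paul's score is $u_T(x_C)$; Paul maximizes and Carol minimizes this score. Its value $u^\varepsilon$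 is thus determined by $u^\varepsilon(t,x)=u_T(x)$ for $t\ge T$ and $$u^\varepsilon(t,x)=\sup_{x_P\in E^+(x)}\ \inf_{x_C\in E^-(x_P)}u^\varepsilon(t_C,x_C)\qquad(t<T).$$ Call a function $u$ on $(0,T]\times\mathbb{R}^N$ a viscosity solution of the terminal value problem $$-\partial_t u-v(x)|Du|=0\ \text{ in }(0,T)\times\mathbb{R}^N,\qquad u(T,\cdot)=u_T,$$ if it is continuous on $(0,T]\times\mathbb{R}^N$, satisfies $u(T,\cdot)=u_T$, and for every $\phi\in C^2((0,T)\times\mathbb{R}^N)$ one has $-\partial_t\phi-v(x)|D\phi|\le 0$ (resp. $\ge 0$) at every point $(t,x)\in(0,T)\times\mathbb{R}^N$ where $u-\phi$ has a local maximum (resp. local minimum). Then this problem has exactly one viscosity solution $u$, and $u^\varepsilon\to u$ locally uniformly on $(0,T]\times\mathbb{R}^N$ as $\varepsilon\to0^+$. -/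

import Mathlib

open Set Filter Topology

noncomputable section

/-- The cut-off `C_ε(r) = (r ∨ ε^{3/2}) ∧ ε^{1/2}`. -/
def cutoff (ε r : ℝ) : ℝ := min (max r (ε ^ (3 / 2 : ℝ))) (ε ^ (1 / 2 : ℝ))

section Moves

variable {N : ℕ}

open Classical in
/-- The set `B_ε(x) ∩ {w > 0}` if it is nonempty, and `{x}` otherwise. Paul's set of moves
is obtained with `w = v` and Carol's with `w = -v`. -/
def moveSet (ε : ℝ) (w : EuclideanSpace ℝ (Fin N) → ℝ) (x : EuclideanSpace ℝ (Fin N)) :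
    Set (EuclideanSpace ℝ (Fin N)) :=
  if (Metric.ball x ε ∩ {y | 0 < w y}).Nonempty then Metric.ball x ε ∩ {y | 0 < w y} else {x}

open Classical in
/-- The time that elapses when a player moves from `x` to `y`: it is `C_ε(ε / w₊(y))` if
`B_ε(x) ∩ {w > 0}` is nonempty, and `ε²` otherwise. Note that `(-v)₊ = v₋`. -/
def moveTime (ε : ℝ) (w : EuclideanSpace ℝ (Fin N) → ℝ) (x y : EuclideanSpace ℝ (Fin N)) : ℝ :=
  if (Metric.ball x ε ∩ {z | 0 < w z}).Nonempty then cutoff ε (ε * ((w y)⁺)⁻¹) else ε ^ 2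

/-- A positive lower bound for every time step. -/
def minStep (ε : ℝ) : ℝ := min (ε ^ 2) (min (ε ^ (3 / 2 : ℝ)) (ε ^ (1 / 2 : ℝ)))

theorem minStep_pos {ε : ℝ} (hε : 0 < ε) : 0 < minStep ε := by
  unfold minStep
  positivity

theorem minStep_le_moveTime (ε : ℝ) (w : EuclideanSpace ℝ (Fin N) → ℝ)
    (x y : EuclideanSpace ℝ (Fin N)) : minStep ε ≤ moveTime ε w x y := by
  unfold moveTime
  split_ifs
  · exact (min_le_right _ _).trans (min_le_min_right _ (le_max_right _ _))
  · exact min_le_left _ _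

theorem game_terminates {T ε t s : ℝ} (hε : 0 < ε) (ht : t < T) (hs : t + minStep ε ≤ s) :
    ⌈(T - s) / minStep ε⌉₊ < ⌈(T - t) / minStep ε⌉₊ := by
  have hm := minStep_pos hε
  have h0 : 0 < (T - t) / minStep ε := div_pos (by linarith) hm
  have h1 : (T - s) / minStep ε ≤ (T - t) / minStep ε - 1 := by
    rw [div_sub_one hm.ne']
    exact div_le_div_of_nonneg_right (by linarith) hm.le
  have h2 := Nat.ceil_mono h1
  rw [Nat.ceil_sub_one] at h2
  have h3 := Nat.ceil_pos.mpr h0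
  omega

/-- The value `u^ε(t, x)` of the game with speed `v`, final time `T` and final score `uT`.
If `t ≥ T` the game is over and Paul collects `uT x`. Otherwise Paul, who maximizes, chooses
`xP ∈ E⁺(x)`, then Carol, who minimizes, chooses `xC ∈ E⁻(xP)`, and the game goes on from `xC`
at the time `t_C` that is reached after the two moves. (The value is only meant for `ε > 0`;
for `ε ≤ 0` it is set to `uT x`.) -/
def gameValue (v uT : EuclideanSpace ℝ (Fin N) → ℝ) (T ε t : ℝ)
    (x : EuclideanSpace ℝ (Fin N)) : ℝ :=
  if _h : T ≤ t ∨ ε ≤ 0 then uT x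
  else
    ⨆ xP : moveSet ε v x, ⨅ xC : moveSet ε (-v) (xP : EuclideanSpace ℝ (Fin N)),
      gameValue v uT T ε
        (t + moveTime ε v x xP + moveTime ε (-v) (xP : EuclideanSpace ℝ (Fin N)) xC) xC
termination_by ⌈(T - t) / minStep ε⌉₊
decreasing_by
  obtain ⟨h1, h2⟩ := not_or.mp _h
  push Not at h1 h2
  refine game_terminates h2 h1 ?_
  have a := minStep_le_moveTime ε v x xP
  have b := minStep_le_moveTime ε (-v) (xP : EuclideanSpace ℝ (Fin N)) xC
  have c := minStep_pos h2
  linarith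

end Moves

/-- Viscosity sub-solution of `-∂ₜu - v(x)|Du| = 0` in `(0,T) × ℝᴺ`. -/
def IsViscositySubsolution {N : ℕ} (v : EuclideanSpace ℝ (Fin N) → ℝ) (T : ℝ)
    (u : ℝ × EuclideanSpace ℝ (Fin N) → ℝ) : Prop :=
  UpperSemicontinuousOn u (Ioo 0 T ×ˢ univ) ∧
  ∀ φ : ℝ × EuclideanSpace ℝ (Fin N) → ℝ, ContDiffOn ℝ 2 φ (Ioo 0 T ×ˢ univ) →
    ∀ (t : ℝ) (x : EuclideanSpace ℝ (Fin N)), t ∈ Ioo 0 T →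
      IsLocalMax (fun p => u p - φ p) (t, x) →
        -deriv (fun s => φ (s, x)) t - v x * ‖gradient (fun y => φ (t, y)) x‖ ≤ 0

/-- Viscosity super-solution of `-∂ₜu - v(x)|Du| = 0` in `(0,T) × ℝᴺ`. -/
def IsViscositySupersolution {N : ℕ} (v : EuclideanSpace ℝ (Fin N) → ℝ) (T : ℝ)
    (u : ℝ × EuclideanSpace ℝ (Fin N) → ℝ) : Prop :=
  LowerSemicontinuousOn u (Ioo 0 T ×ˢ univ) ∧
  ∀ φ : ℝ × EuclideanSpace ℝ (Fin N) → ℝ, ContDiffOn ℝ 2 φ (Ioo 0 T ×ˢ univ) →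
    ∀ (t : ℝ) (x : EuclideanSpace ℝ (Fin N)), t ∈ Ioo 0 T →
      IsLocalMin (fun p => u p - φ p) (t, x) →
        0 ≤ -deriv (fun s => φ (s, x)) t - v x * ‖gradient (fun y => φ (t, y)) x‖

/-- Viscosity solution of the terminal value problem `-∂ₜu - v(x)|Du| = 0` in `(0,T) × ℝᴺ`,
`u(T,·) = uT`; the terminal datum is attained continuously. Only the values of `u` on
`(0,T] × ℝᴺ` matter. -/
structure IsTerminalViscositySolution {N : ℕ} (v uT : EuclideanSpace ℝ (Fin N) → ℝ) (T : ℝ)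
    (u : ℝ × EuclideanSpace ℝ (Fin N) → ℝ) : Prop where
  continuousOn : ContinuousOn u (Ioc 0 T ×ˢ univ)
  subsolution : IsViscositySubsolution v T u
  supersolution : IsViscositySupersolution v T u
  terminal : ∀ x, u (T, x) = uT x

end

/-! The proof is the method of half-relaxed limits. The values `u^ε` are bounded by `sup |uT|`, so
their upper and lower relaxed limits `U` and `W` as `ε → 0⁺` are finite, and `W ≤ U`.

Consistency makes `U` a subsolution and `W` a supersolution. Let a test function `φ` have time
derivative `a` and gradient `g` with `a + v|g| < 0`. Where `v ≥ 0` no round moves faster than about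
`v`, so every round decreases `φ`. Where `v < 0` Paul is stuck and Carol decreases `φ` by stepping
against `g`. The supersolution case is dual, so a change of sign of `v` needs no separate analysis.
A scheme that lowers `φ` in each round is incompatible with a strict maximum of `U - φ`
(`false_of_scheme_of_strict_max`).

At time `T` both limits equal `uT`: the speed grows at most linearly, so a Gronwall bound controls
how far the game drifts before it ends (`abs_gameValue_sub_le`).

Comparison (`viscosity_comparison`) gives `U ≤ W`. It needs no growth condition on the functions,
because linear growth of the speed makes the dependence on the data local: a weight confines the
maximum points to a compact set. Hence `U = W` is continuous, is the unique solution, and is the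
joint limit of `u^ε`, which amounts to locally uniform convergence. -/

noncomputable section

/-! ### Doubling of variables -/

/-- Doubling of variables: the maxima of `f p + h q - n * pen p q` over `K × K` accumulate, as
`n → ∞`, at a maximum point of `f + h` over `K`, and the penalization vanishes in the limit. -/
theorem exists_doubling_maxima {X : Type*} [MetricSpace X] {K : Set X} (hK : IsCompact K)
    (hne : K.Nonempty) {f h : X → ℝ} (hf : UpperSemicontinuousOn f K)
    (hh : UpperSemicontinuousOn h K) {pen : X → X → ℝ}
    (hpc : Continuous fun p : X × X => pen p.1 p.2) (hp0 : ∀ p, pen p p = 0)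
    (hpn : ∀ p q, 0 ≤ pen p q) (hp : ∀ p q, pen p q = 0 → p = q) :
    ∃ c ∈ K, (∀ p ∈ K, f p + h p ≤ f c + h c) ∧
      ∃ (n : ℕ → ℕ) (a b : ℕ → X), (∀ k, a k ∈ K ∧ b k ∈ K ∧ ∀ p ∈ K, ∀ q ∈ K,
        f p + h q - n k * pen p q ≤ f (a k) + h (b k) - n k * pen (a k) (b k)) ∧
      Tendsto a atTop (𝓝 c) ∧ Tendsto b atTop (𝓝 c) ∧
      Tendsto (fun k => n k * pen (a k) (b k)) atTop (𝓝 0) := by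
  have hmax : ∀ n : ℕ, ∃ z ∈ K ×ˢ K, IsMaxOn
      (fun z : X × X => f z.1 + h z.2 + -(n * pen z.1 z.2)) (K ×ˢ K) z := by
    intro n
    refine UpperSemicontinuousOn.exists_isMaxOn (hne.prod hne) (hK.prod hK) ?_
    refine UpperSemicontinuousOn.add (UpperSemicontinuousOn.add ?_ ?_) ?_
    · exact hf.comp continuousOn_fst (fun z hz => hz.1)
    · exact hh.comp continuousOn_snd (fun z hz => hz.2)
    · exact ContinuousOn.upperSemicontinuousOn (by fun_prop)
  choose z hzK hz using hmax
  obtain ⟨c, hc, ρ, hρ, hlim⟩ := (hK.prod hK).tendsto_subseq hzK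
  obtain ⟨M, hM⟩ := hf.bddAbove_of_isCompact hK
  obtain ⟨M', hM'⟩ := hh.bddAbove_of_isCompact hK
  obtain ⟨k0, hk0⟩ := hne
  have hzm : ∀ n, ∀ p ∈ K, ∀ q ∈ K,
      f p + h q - n * pen p q ≤ f (z n).1 + h (z n).2 - n * pen (z n).1 (z n).2 := by
    intro n p hp q hq
    have := hz n (show (p, q) ∈ K ×ˢ K from ⟨hp, hq⟩)
    simp only [mem_ofPred_eq] at this
    linarith
  have hpos : ∀ n : ℕ, 0 ≤ n * pen (z n).1 (z n).2 := fun n =>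
    mul_nonneg n.cast_nonneg (hpn _ _)
  -- Comparison with one fixed diagonal pair bounds the penalization, so `pen` itself tends to `0`
  -- and the limit pair lies on the diagonal.
  have hbd : ∀ n : ℕ, n * pen (z n).1 (z n).2 ≤ M + M' - (f k0 + h k0) := by
    intro n
    have h1 := hzm n k0 hk0 k0 hk0
    have h2 := hM ⟨_, (hzK n).1, rfl⟩
    have h3 := hM' ⟨_, (hzK n).2, rfl⟩
    rw [hp0] at h1
    linarith
  have ha : Tendsto (fun k => (z (ρ k)).1) atTop (𝓝 c.1) := (continuous_fst.tendsto c).comp hlim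
  have hb : Tendsto (fun k => (z (ρ k)).2) atTop (𝓝 c.2) := (continuous_snd.tendsto c).comp hlim
  have hpl : Tendsto (fun k => pen (z (ρ k)).1 (z (ρ k)).2) atTop (𝓝 (pen c.1 c.2)) :=
    (hpc.tendsto c).comp hlim
  have hp0l : Tendsto (fun k => pen (z (ρ k)).1 (z (ρ k)).2) atTop (𝓝 0) := by
    have h1 : Tendsto (fun n : ℕ => (M + M' - (f k0 + h k0)) / (n : ℝ)) atTop (𝓝 0) :=
      tendsto_const_div_atTop_nhds_zero_nat _
    refine tendsto_of_tendsto_of_tendsto_of_le_of_le' tendsto_const_nhds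
      (h1.comp hρ.tendsto_atTop) (Eventually.of_forall fun k => hpn _ _) ?_
    filter_upwards [hρ.tendsto_atTop.eventually_gt_atTop 0] with k hk
    have hk' : (0 : ℝ) < ρ k := by exact_mod_cast hk
    simp only [Function.comp]
    rw [le_div_iff₀ hk', mul_comm]
    exact hbd _
  have hcc : c.1 = c.2 := hp _ _ (tendsto_nhds_unique hpl hp0l)
  rw [← hcc] at hb
  have hev : ∀ e > 0, ∀ᶠ k in atTop,
      f (z (ρ k)).1 + h (z (ρ k)).2 < f c.1 + h c.1 + e := by
    intro e he
    have h1 := (tendsto_nhdsWithin_iff.mpr ⟨ha, Eventually.of_forall fun k => (hzK (ρ k)).1⟩).eventually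
      (hf c.1 hc.1 (f c.1 + e / 2) (by linarith))
    have h2 := (tendsto_nhdsWithin_iff.mpr ⟨hb, Eventually.of_forall fun k => (hzK (ρ k)).2⟩).eventually
      (hh c.1 hc.1 (h c.1 + e / 2) (by linarith))
    filter_upwards [h1, h2] with k h1 h2
    linarith
  have hcmax : ∀ p ∈ K, f p + h p ≤ f c.1 + h c.1 := by
    intro p hpK
    refine le_of_forall_pos_le_add fun e he => ?_
    obtain ⟨k, hk⟩ := (hev e he).exists
    have h1 := hzm (ρ k) p hpK p hpK
    rw [hp0] at h1
    have := hpos (ρ k)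
    linarith
  refine ⟨c.1, hc.1, hcmax, ρ, fun k => (z (ρ k)).1, fun k => (z (ρ k)).2,
    fun k => ⟨(hzK _).1, (hzK _).2, hzm (ρ k)⟩, ha, hb, ?_⟩
  -- Comparison with the pair `(c, c)` bounds the penalization by the excess of `f + h` over its
  -- value at `c`, which semicontinuity makes small.
  rw [Metric.tendsto_atTop']
  intro e he
  obtain ⟨m, hm⟩ := eventually_atTop.mp (hev e he)
  refine ⟨m, fun k hk => ?_⟩
  have h1 := hm k hk.le
  have h2 := hzm (ρ k) c.1 hc.1 c.1 hc.1
  rw [hp0] at h2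
  rw [Real.dist_0_eq_abs, abs_of_nonneg (hpos _)]
  linarith

/-! ### Comparison principle -/

section Comparison

variable {N : ℕ}

theorem hasGradientAt_norm_sub_sq (y x : EuclideanSpace ℝ (Fin N)) :
    HasGradientAt (fun z => ‖z - y‖ ^ 2) ((2 : ℝ) • (x - y)) x := by
  rw [hasGradientAt_iff_hasFDerivAt]
  have h := ((hasFDerivAt_id x).sub_const y).norm_sq
  refine h.congr_fderiv ?_
  ext z
  simp

/-- The weight `c * ((1 + |x - x₀|²) * exp (-k t)) ^ n` that confines maximum points. -/
def coneWeight (x₀ : EuclideanSpace ℝ (Fin N)) (k c : ℝ) (n : ℕ)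
    (p : ℝ × EuclideanSpace ℝ (Fin N)) : ℝ :=
  c * ((1 + ‖p.2 - x₀‖ ^ 2) * Real.exp (-(k * p.1))) ^ n

theorem contDiff_coneWeight (x₀ : EuclideanSpace ℝ (Fin N)) (k c : ℝ) (n : ℕ) :
    ContDiff ℝ 2 (coneWeight x₀ k c n) := by
  unfold coneWeight
  refine contDiff_const.mul (ContDiff.pow (ContDiff.mul ?_ ?_) n)
  · exact contDiff_const.add ((contDiff_snd.sub contDiff_const).norm_sq ℝ)
  · fun_prop

theorem hasDerivAt_coneWeight (x₀ : EuclideanSpace ℝ (Fin N)) (k c : ℝ) (n : ℕ) (t : ℝ)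
    (x : EuclideanSpace ℝ (Fin N)) :
    HasDerivAt (fun s => coneWeight x₀ k c (n + 1) (s, x))
      (-((n + 1) * k * coneWeight x₀ k c (n + 1) (t, x))) t := by
  unfold coneWeight
  have h1 : HasDerivAt (fun s : ℝ => Real.exp (-(k * s))) (Real.exp (-(k * t)) * -(k * 1)) t :=
    (((hasDerivAt_id t).const_mul k).neg).exp
  have h2 := ((h1.const_mul (1 + ‖x - x₀‖ ^ 2)).pow (n + 1)).const_mul c
  refine h2.congr_deriv ?_
  push_cast
  ring

theorem hasGradientAt_coneWeight (x₀ : EuclideanSpace ℝ (Fin N)) (k c : ℝ) (n : ℕ) (t : ℝ)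
    (x : EuclideanSpace ℝ (Fin N)) :
    HasGradientAt (fun y => coneWeight x₀ k c (n + 1) (t, y))
      ((c * ((n + 1) * ((1 + ‖x - x₀‖ ^ 2) * Real.exp (-(k * t))) ^ n *
        Real.exp (-(k * t)) * 2)) • (x - x₀)) x := by
  unfold coneWeight
  have h1 := (hasGradientAt_norm_sub_sq x₀ x).hasFDerivAt
  have h2 : HasDerivAt (fun r : ℝ => c * ((1 + r) * Real.exp (-(k * t))) ^ (n + 1))
      (c * ((n + 1) * ((1 + ‖x - x₀‖ ^ 2) * Real.exp (-(k * t))) ^ n * Real.exp (-(k * t))))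
      (‖x - x₀‖ ^ 2) := by
    have := ((((hasDerivAt_id (‖x - x₀‖ ^ 2)).const_add 1).mul_const
      (Real.exp (-(k * t)))).pow (n + 1)).const_mul c
    refine this.congr_deriv ?_
    push_cast
    simp
  rw [hasGradientAt_iff_hasFDerivAt]
  refine (h2.comp_hasFDerivAt x h1).congr_fderiv ?_
  ext z
  simp
  ring

/-- The weight is a strict supersolution where the speed is at most `A + L |x - x₀|`. -/
theorem coneWeight_speed_bound (x₀ : EuclideanSpace ℝ (Fin N)) {A L c s : ℝ} (hA : 0 ≤ A)
    (hL : 0 ≤ L) (hc : 0 ≤ c) (n : ℕ) (t : ℝ) (x : EuclideanSpace ℝ (Fin N)) {k : ℝ}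
    (hk : A + 2 * L + 1 ≤ k) (hs : s ≤ A + L * ‖x - x₀‖) :
    s * ‖(c * ((n + 1) * ((1 + ‖x - x₀‖ ^ 2) * Real.exp (-(k * t))) ^ n *
        Real.exp (-(k * t)) * 2)) • (x - x₀)‖ + coneWeight x₀ k c (n + 1) (t, x) ≤
      (n + 1) * k * coneWeight x₀ k c (n + 1) (t, x) := by
  unfold coneWeight
  set r := ‖x - x₀‖ with hr
  have hr0 : 0 ≤ r := norm_nonneg _
  set e := Real.exp (-(k * t))
  have he : 0 < e := Real.exp_pos _
  set Q := ((1 + r ^ 2) * e) ^ n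
  have hQ : 0 ≤ Q := by positivity
  have hcoef : 0 ≤ c * ((n + 1) * Q * e * 2) := by positivity
  rw [norm_smul, Real.norm_of_nonneg hcoef, ← hr]
  rw [pow_succ]
  change s * (c * ((n + 1) * Q * e * 2) * r) + c * (Q * ((1 + r ^ 2) * e)) ≤
    (n + 1) * k * (c * (Q * ((1 + r ^ 2) * e)))
  -- From `2r ≤ 1 + r²`. The remaining `1` in the lower bound for `k` yields the strictness.
  have h1 : s * (2 * r) ≤ (A + 2 * L) * (1 + r ^ 2) := by
    have : s * (2 * r) ≤ (A + L * r) * (2 * r) := mul_le_mul_of_nonneg_right hs (by positivity)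
    nlinarith [mul_nonneg hA (sq_nonneg (r - 1))]
  have h2 : s * (2 * r) + (1 + r ^ 2) ≤ k * (1 + r ^ 2) := by nlinarith [sq_nonneg r]
  have hn : (1 : ℝ) ≤ n + 1 := by have := n.cast_nonneg (α := ℝ); linarith
  have h3 : (n + 1) * (s * (2 * r)) + (1 + r ^ 2) ≤ (n + 1) * (k * (1 + r ^ 2)) := by
    have := mul_le_mul_of_nonneg_left h2 (by linarith : (0 : ℝ) ≤ n + 1)
    nlinarith [sq_nonneg r]
  have h4 := mul_le_mul_of_nonneg_left h3 (by positivity : 0 ≤ c * Q * e)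
  linarith

/-- Existence of the weight parameters: small at the vertex, large outside a compact cylinder. -/
theorem exists_coneWeight {x₀ : EuclideanSpace ℝ (Fin N)} {t₀ a k η M : ℝ} (hk : 0 < k)
    (ha : a < t₀) (hη : 0 < η) :
    ∃ (c : ℝ) (n : ℕ), 0 < c ∧ coneWeight x₀ k c (n + 1) (t₀, x₀) = η ∧
      ∀ t x, Real.exp (-(k * a)) ≤ (1 + ‖x - x₀‖ ^ 2) * Real.exp (-(k * t)) →
        M < coneWeight x₀ k c (n + 1) (t, x) := by
  have h1 : 1 < Real.exp (k * (t₀ - a)) := Real.one_lt_exp_iff.mpr (mul_pos hk (by linarith))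
  obtain ⟨n, hn⟩ := pow_unbounded_of_one_lt (M / η) h1
  have hn' : M / η < Real.exp (k * (t₀ - a)) ^ (n + 1) :=
    hn.trans (pow_lt_pow_right₀ h1 n.lt_succ_self)
  rw [div_lt_iff₀ hη] at hn'
  -- With this factor the weight is `η * ((1 + |x - x₀|²) * exp (k (t₀ - t))) ^ (n + 1)`: it is `η`
  -- at the vertex, and in the outer region the base is at least `exp (k (t₀ - a)) > 1`, so a large
  -- power exceeds `M`.
  refine ⟨η * Real.exp (k * t₀) ^ (n + 1), n, by positivity, ?_, fun t x hx => ?_⟩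
  · simp [coneWeight, mul_assoc, ← mul_pow, ← Real.exp_add]
  · have h2 : Real.exp (k * (t₀ - a)) = Real.exp (k * t₀) * Real.exp (-(k * a)) := by
      rw [← Real.exp_add]; ring_nf
    unfold coneWeight
    calc M < η * Real.exp (k * t₀) ^ (n + 1) * Real.exp (-(k * a)) ^ (n + 1) := by
          rw [h2, mul_pow] at hn'; linarith
      _ ≤ _ := by
          gcongr

/-- The quadratic penalization of the distance between two space-time points. -/
def sqPen (p q : ℝ × EuclideanSpace ℝ (Fin N)) : ℝ :=
  (p.1 - q.1) ^ 2 + ‖p.2 - q.2‖ ^ 2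

theorem contDiff_sqPen (q : ℝ × EuclideanSpace ℝ (Fin N)) :
    ContDiff ℝ 2 (fun p => sqPen p q) := by
  unfold sqPen
  exact ((contDiff_fst.sub contDiff_const).pow 2).add
    ((contDiff_snd.sub contDiff_const).norm_sq ℝ)

theorem sqPen_comm (p q : ℝ × EuclideanSpace ℝ (Fin N)) : sqPen p q = sqPen q p := by
  unfold sqPen
  rw [norm_sub_rev]
  ring

theorem sqPen_nonneg (p q : ℝ × EuclideanSpace ℝ (Fin N)) : 0 ≤ sqPen p q := by
  unfold sqPen
  positivity

theorem sqPen_self (p : ℝ × EuclideanSpace ℝ (Fin N)) : sqPen p p = 0 := by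
  simp [sqPen]

theorem eq_of_sqPen_eq_zero {p q : ℝ × EuclideanSpace ℝ (Fin N)} (h : sqPen p q = 0) :
    p = q := by
  unfold sqPen at h
  have h1 : (p.1 - q.1) ^ 2 = 0 := by nlinarith [sq_nonneg (p.1 - q.1), sq_nonneg ‖p.2 - q.2‖]
  have h2 : ‖p.2 - q.2‖ ^ 2 = 0 := by nlinarith [sq_nonneg (p.1 - q.1), sq_nonneg ‖p.2 - q.2‖]
  refine Prod.ext ?_ ?_
  · exact sub_eq_zero.mp (by simpa using h1)
  · exact sub_eq_zero.mp (by simpa using h2)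

theorem continuous_sqPen : Continuous fun p : (ℝ × EuclideanSpace ℝ (Fin N)) ×
    (ℝ × EuclideanSpace ℝ (Fin N)) => sqPen p.1 p.2 := by
  unfold sqPen
  fun_prop

theorem hasDerivAt_sqPen (q : ℝ × EuclideanSpace ℝ (Fin N)) (t : ℝ)
    (x : EuclideanSpace ℝ (Fin N)) :
    HasDerivAt (fun s => sqPen (s, x) q) (2 * (t - q.1)) t := by
  unfold sqPen
  refine (((((hasDerivAt_id' t).sub_const q.1).fun_pow 2).add_const
    (‖x - q.2‖ ^ 2))).congr_deriv ?_
  simp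

theorem hasGradientAt_sqPen (q : ℝ × EuclideanSpace ℝ (Fin N)) (t : ℝ)
    (x : EuclideanSpace ℝ (Fin N)) :
    HasGradientAt (fun y => sqPen (t, y) q) ((2 : ℝ) • (x - q.2)) x := by
  rw [hasGradientAt_iff_hasFDerivAt]
  exact (hasGradientAt_norm_sub_sq q.2 x).hasFDerivAt.const_add ((t - q.1) ^ 2)

/-- The viscosity inequalities at a maximum of `u p - w q - ψ p - j * sqPen p q`. -/
theorem weight_le_of_doubling_max {v : EuclideanSpace ℝ (Fin N) → ℝ} {L : NNReal}
    (hv : LipschitzWith L v) {T : ℝ} {u w : ℝ × EuclideanSpace ℝ (Fin N) → ℝ}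
    (hu : IsViscositySubsolution v T u) (hw : IsViscositySupersolution v T w)
    {x₀ : EuclideanSpace ℝ (Fin N)} {k c : ℝ} (hk : |v x₀| + 2 * L + 1 ≤ k) (hc : 0 ≤ c)
    {n : ℕ} {j : ℝ} (hj : 0 ≤ j) {p q : ℝ × EuclideanSpace ℝ (Fin N)} (hp : p.1 ∈ Ioo 0 T)
    (hq : q.1 ∈ Ioo 0 T)
    (hmax : ∀ᶠ p' in 𝓝 p, u p' - coneWeight x₀ k c (n + 1) p' - j * sqPen p' q ≤
      u p - coneWeight x₀ k c (n + 1) p - j * sqPen p q)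
    (hmin : ∀ᶠ q' in 𝓝 q, w q + j * sqPen p q ≤ w q' + j * sqPen p q') :
    coneWeight x₀ k c (n + 1) p ≤ 2 * L * (j * sqPen p q) := by
  obtain ⟨t, x⟩ := p
  obtain ⟨s, y⟩ := q
  have h1 := hu.2 (fun p' => coneWeight x₀ k c (n + 1) p' + j * sqPen p' (s, y))
    ((contDiff_coneWeight x₀ k c (n + 1)).add
      (contDiff_const.mul (contDiff_sqPen (s, y)))).contDiffOn t x hp
    (hmax.mono fun p' h => by dsimp only; linarith)
  have h2 := hw.2 (fun q' => -j * sqPen q' (t, x))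
    (contDiff_const.mul (contDiff_sqPen (t, x))).contDiffOn s y hq
    (hmin.mono fun q' h => by
      dsimp only
      rw [sqPen_comm q', sqPen_comm (s, y)]
      linarith)
  rw [((hasDerivAt_coneWeight x₀ k c n t x).fun_add
    ((hasDerivAt_sqPen (s, y) t x).const_mul j)).deriv] at h1
  rw [((hasDerivAt_sqPen (t, x) s y).const_mul (-j)).deriv] at h2
  have g1 : HasGradientAt (fun y' => coneWeight x₀ k c (n + 1) (t, y') + j * sqPen (t, y') (s, y))
      ((c * ((n + 1) * ((1 + ‖x - x₀‖ ^ 2) * Real.exp (-(k * t))) ^ n *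
        Real.exp (-(k * t)) * 2)) • (x - x₀) + j • (2 : ℝ) • (x - y)) x := by
    rw [hasGradientAt_iff_hasFDerivAt]
    refine ((hasGradientAt_coneWeight x₀ k c n t x).hasFDerivAt.fun_add
      ((hasGradientAt_sqPen (s, y) t x).hasFDerivAt.const_mul j)).congr_fderiv ?_
    simp only [map_add, map_smul]
  have g2 : HasGradientAt (fun y' => -j * sqPen (s, y') (t, x)) ((-j) • (2 : ℝ) • (y - x)) y := by
    rw [hasGradientAt_iff_hasFDerivAt]
    refine ((hasGradientAt_sqPen (t, x) s y).hasFDerivAt.const_mul (-j)).congr_fderiv ?_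
    simp only [map_smul]
  rw [g1.gradient] at h1
  rw [g2.gradient] at h2
  have hvx : |v x| ≤ |v x₀| + L * ‖x - x₀‖ := by
    have := hv.norm_sub_le x x₀
    rw [Real.norm_eq_abs] at this
    have := abs_sub_abs_le_abs_sub (v x) (v x₀)
    linarith
  have hcone := coneWeight_speed_bound x₀ (abs_nonneg (v x₀)) L.2 hc n t x hk hvx
  set W := coneWeight x₀ k c (n + 1) (t, x)
  set D := (c * ((n + 1) * ((1 + ‖x - x₀‖ ^ 2) * Real.exp (-(k * t))) ^ n *
        Real.exp (-(k * t)) * 2)) • (x - x₀)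
  set P := j • (2 : ℝ) • (x - y)
  -- The penalization contributes the same time derivative and the same gradient `P` to both test
  -- functions. On subtraction the time parts cancel, and only `|v x| ‖D‖`, absorbed by the weight,
  -- and `(v x - v y) ‖P‖` remain.
  have hP : (-j) • (2 : ℝ) • (y - x) = P := by
    simp only [P, neg_smul, ← smul_neg, neg_sub]
  have hPn : ‖P‖ = 2 * j * ‖x - y‖ := by
    simp only [P, norm_smul, Real.norm_of_nonneg hj]
    norm_num
    ring
  rw [hP] at h2
  have h3 : v x * ‖D + P‖ - v x * ‖P‖ ≤ |v x| * ‖D‖ := by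
    rw [← mul_sub]
    refine (le_abs_self _).trans ?_
    rw [abs_mul]
    refine mul_le_mul_of_nonneg_left ?_ (abs_nonneg _)
    have := abs_norm_sub_norm_le (D + P) P
    rwa [add_sub_cancel_right] at this
  have h4 : (v x - v y) * ‖P‖ ≤ L * ‖x - y‖ * ‖P‖ := by
    refine mul_le_mul_of_nonneg_right ((le_abs_self _).trans ?_) (norm_nonneg _)
    simpa using hv.norm_sub_le x y
  have h5 : L * ‖x - y‖ * (2 * j * ‖x - y‖) ≤ 2 * L * (j * sqPen (t, x) (s, y)) := by
    have : 0 ≤ 2 * L * j * (t - s) ^ 2 := by positivity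
    unfold sqPen
    dsimp only
    linarith
  rw [← hPn] at h5
  linarith

/-- Comparison principle. No growth condition is needed. -/
theorem viscosity_comparison {v : EuclideanSpace ℝ (Fin N) → ℝ} {L : NNReal}
    (hv : LipschitzWith L v) {T : ℝ} {u w : ℝ × EuclideanSpace ℝ (Fin N) → ℝ}
    (hu : IsViscositySubsolution v T u) (hw : IsViscositySupersolution v T w)
    (huc : UpperSemicontinuousOn u (Ioc 0 T ×ˢ univ))
    (hwc : LowerSemicontinuousOn w (Ioc 0 T ×ˢ univ)) (hT : ∀ x, u (T, x) ≤ w (T, x))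
    {p : ℝ × EuclideanSpace ℝ (Fin N)} (hp : p ∈ Ioc 0 T ×ˢ (univ : Set _)) : u p ≤ w p := by
  obtain ⟨t₀, x₀⟩ := p
  have ht₀ : t₀ ∈ Ioc 0 T := hp.1
  by_contra! hlt
  set η := (u (t₀, x₀) - w (t₀, x₀)) / 2 with hηdef
  have hη : 0 < η := by rw [hηdef]; linarith
  set a := t₀ / 2 with hadef
  have ha0 : 0 < a := by rw [hadef]; linarith [ht₀.1]
  have hat : a < t₀ := by rw [hadef]; linarith [ht₀.1]
  set k := |v x₀| + 2 * L + 1 with hkdef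
  have hk : 0 < k := by positivity
  set R := Real.exp (k * T)
  have hR : 0 < R := Real.exp_pos _
  set K := Icc a T ×ˢ Metric.closedBall x₀ R with hKdef
  have hKc : IsCompact K := isCompact_Icc.prod (isCompact_closedBall _ _)
  have hp₀ : (t₀, x₀) ∈ K := ⟨⟨hat.le, ht₀.2⟩, Metric.mem_closedBall_self hR.le⟩
  have hKs : K ⊆ Ioc 0 T ×ˢ univ := fun z hz => ⟨⟨ha0.trans_le hz.1.1, hz.1.2⟩, mem_univ _⟩
  have hnw : UpperSemicontinuousOn (fun z => -w z) K := by
    intro z hz y hy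
    filter_upwards [(hwc.mono hKs) z hz (-y) (by linarith)] with z' hz'
    linarith
  obtain ⟨M, hM⟩ := (huc.mono hKs).bddAbove_of_isCompact hKc
  obtain ⟨M', hM'⟩ := hnw.bddAbove_of_isCompact hKc
  obtain ⟨c, n, hc, hc₀, hbig⟩ := exists_coneWeight (x₀ := x₀) (M := M + M') hk hat hη
  have hψ : ∀ z, 0 < coneWeight x₀ k c (n + 1) z := fun z => by
    unfold coneWeight
    positivity
  have hf : UpperSemicontinuousOn (fun z => u z + -coneWeight x₀ k c (n + 1) z) K :=
    (huc.mono hKs).add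
      (contDiff_coneWeight x₀ k c (n + 1)).continuous.neg.continuousOn.upperSemicontinuousOn
  obtain ⟨z, hzK, hzmax, j, α, β, hαβ, hα, hβ, hpen⟩ :=
    exists_doubling_maxima hKc ⟨_, hp₀⟩ hf hnw continuous_sqPen sqPen_self sqPen_nonneg
      (fun _ _ => eq_of_sqPen_eq_zero)
  have hz0 := hzmax _ hp₀
  rw [hc₀] at hz0
  -- At the vertex `u - w` minus the weight is `2η - η > 0`, so it is positive at the maximum point
  -- `z`. This keeps `z` off the final time, where `u ≤ w`, and off the bottom and lateral boundary,
  -- where the weight exceeds `sup (u - w)`.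
  have hz1 : coneWeight x₀ k c (n + 1) z < u z - w z := by linarith
  have hz2 : u z - w z ≤ M + M' := by
    have h1 := hM ⟨z, hzK, rfl⟩
    have h2 := hM' ⟨z, hzK, rfl⟩
    dsimp only at h2
    linarith
  have hzT : z.1 < T := by
    refine lt_of_le_of_ne hzK.1.2 fun h => ?_
    have h1 := hT z.2
    rw [← h] at h1
    have := hψ z
    linarith
  have hza : a < z.1 := by
    refine lt_of_le_of_ne hzK.1.1 fun h => ?_
    have := hbig z.1 z.2 (by
      rw [← h]
      exact le_mul_of_one_le_left (Real.exp_pos _).le (by nlinarith [sq_nonneg ‖z.2 - x₀‖]))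
    exact absurd (this.trans hz1) (not_lt.mpr hz2)
  have hzR : z.2 ∈ Metric.ball x₀ R := by
    refine lt_of_le_of_ne (Metric.mem_closedBall.mp hzK.2) fun h => ?_
    have := hbig z.1 z.2 (by
      rw [dist_eq_norm] at h
      rw [h]
      have h1 : Real.exp (-(k * a)) ≤ 1 := Real.exp_le_one_iff.mpr (by nlinarith)
      have h2 : Real.exp (-(k * T)) ≤ Real.exp (-(k * z.1)) :=
        Real.exp_le_exp.mpr (by nlinarith)
      have h3 : R * Real.exp (-(k * T)) = 1 := by
        rw [← Real.exp_add]; simp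
      have h4 : 1 ≤ R := Real.one_le_exp (by nlinarith [ht₀.1, ht₀.2])
      nlinarith [mul_le_mul_of_nonneg_left h2 (by positivity : 0 ≤ 1 + R ^ 2),
        Real.exp_pos (-(k * T))])
    exact absurd (this.trans hz1) (not_lt.mpr hz2)
  have hopen : IsOpen (Ioo a T ×ˢ Metric.ball x₀ R) := isOpen_Ioo.prod Metric.isOpen_ball
  have hzo : Ioo a T ×ˢ Metric.ball x₀ R ∈ 𝓝 z := hopen.mem_nhds ⟨⟨hza, hzT⟩, hzR⟩
  have hoK : Ioo a T ×ˢ Metric.ball x₀ R ⊆ K :=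
    prod_mono Ioo_subset_Icc_self Metric.ball_subset_closedBall
  have hψl := ((contDiff_coneWeight x₀ k c (n + 1)).continuous.tendsto z).comp hα
  have hcontra : ∀ᶠ i in atTop,
      coneWeight x₀ k c (n + 1) (α i) ≤ 2 * L * (j i * sqPen (α i) (β i)) := by
    filter_upwards [hα.eventually_mem hzo, hβ.eventually_mem hzo] with i h1 h2
    refine weight_le_of_doubling_max hv hu hw hkdef.ge hc.le (j i).cast_nonneg
      ⟨ha0.trans h1.1.1, h1.1.2⟩ ⟨ha0.trans h2.1.1, h2.1.2⟩ ?_ ?_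
    · filter_upwards [hopen.mem_nhds h1] with p' hp'
      have := (hαβ i).2.2 p' (hoK hp') (β i) (hoK h2)
      linarith
    · filter_upwards [hopen.mem_nhds h2] with q' hq'
      have := (hαβ i).2.2 (α i) (hoK h1) q' (hoK hq')
      linarith
  have := le_of_tendsto_of_tendsto hψl (hpen.const_mul (2 * (L : ℝ))) hcontra
  rw [mul_zero] at this
  exact absurd this (not_le.mpr (hψ z))

end Comparison

/-! ### Relaxed limits and strict maxima -/

section Relaxed

variable {X : Type*}

/-- The upper relaxed limit of `f ε` as `ε → 0⁺`. -/
def upperRelaxed [TopologicalSpace X] (f : ℝ → X → ℝ) (z : X) : ℝ :=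
  limsup (fun p : ℝ × X => f p.1 p.2) (𝓝[>] 0 ×ˢ 𝓝 z)

section Topological

variable [TopologicalSpace X] {f : ℝ → X → ℝ} {M : ℝ}

theorem eventually_lt_of_upperRelaxed_lt (hM : ∀ ε z, |f ε z| ≤ M) {z : X} {b : ℝ}
    (h : upperRelaxed f z < b) : ∀ᶠ p : ℝ × X in 𝓝[>] 0 ×ˢ 𝓝 z, f p.1 p.2 < b :=
  eventually_lt_of_limsup_lt h
    (isBoundedUnder_of ⟨M, fun p => (abs_le.mp (hM p.1 p.2)).2⟩)

theorem frequently_lt_of_lt_upperRelaxed (hM : ∀ ε z, |f ε z| ≤ M) {z : X} {b : ℝ}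
    (h : b < upperRelaxed f z) : ∃ᶠ p : ℝ × X in 𝓝[>] 0 ×ˢ 𝓝 z, b < f p.1 p.2 :=
  frequently_lt_of_lt_limsup
    (isBoundedUnder_of ⟨-M, fun p => (abs_le.mp (hM p.1 p.2)).1⟩).isCoboundedUnder_flip h

theorem upperRelaxed_le_of_eventually_le (hM : ∀ ε z, |f ε z| ≤ M) {z : X} {b : ℝ}
    (h : ∀ᶠ p : ℝ × X in 𝓝[>] 0 ×ˢ 𝓝 z, f p.1 p.2 ≤ b) : upperRelaxed f z ≤ b := by
  by_contra! hlt
  obtain ⟨p, h1, h2⟩ := ((frequently_lt_of_lt_upperRelaxed hM hlt).and_eventually h).exists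
  exact absurd h1 (not_lt.mpr h2)

theorem upperRelaxed_eq_of_tendsto {z : X} {c : ℝ}
    (h : Tendsto (fun p : ℝ × X => f p.1 p.2) (𝓝[>] 0 ×ˢ 𝓝 z) (𝓝 c)) :
    upperRelaxed f z = c :=
  h.limsup_eq

/-- A bound valid on a product neighbourhood at `z` is valid on one at every nearby point. -/
theorem upperSemicontinuous_upperRelaxed (hM : ∀ ε z, |f ε z| ≤ M) :
    UpperSemicontinuous (upperRelaxed f) := by
  intro z b hb
  obtain ⟨b', h1, h2⟩ := exists_between hb
  obtain ⟨P, hP, Q, hQ, hPQ⟩ := eventually_prod_iff.mp (eventually_lt_of_upperRelaxed_lt hM h1)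
  filter_upwards [eventually_eventually_nhds.mpr hQ] with y hy
  refine lt_of_le_of_lt (upperRelaxed_le_of_eventually_le hM ?_) h2
  exact eventually_prod_iff.mpr ⟨P, hP, Q, hy, fun {_} h {_} h' => (hPQ h h').le⟩

theorem neg_upperRelaxed_neg_le (hM : ∀ ε z, |f ε z| ≤ M) (z : X) :
    -upperRelaxed (fun ε z => -f ε z) z ≤ upperRelaxed f z := by
  by_contra! hlt
  obtain ⟨b, h1, h2⟩ := exists_between hlt
  have hM' : ∀ ε z, |-f ε z| ≤ M := fun ε z => by rw [abs_neg]; exact hM ε z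
  have h3 := eventually_lt_of_upperRelaxed_lt hM h1
  have h4 := eventually_lt_of_upperRelaxed_lt hM' (lt_neg_of_lt_neg h2)
  obtain ⟨p, h5, h6⟩ := (h3.and h4).exists
  linarith

/-- The lower relaxed limit is written as minus the upper relaxed limit of `-f`, so the hypothesis
is `limsup ≤ liminf`. -/
theorem tendsto_of_upperRelaxed_le (hM : ∀ ε z, |f ε z| ≤ M) {z : X}
    (h : upperRelaxed f z ≤ -upperRelaxed (fun ε z => -f ε z) z) :
    Tendsto (fun p : ℝ × X => f p.1 p.2) (𝓝[>] 0 ×ˢ 𝓝 z) (𝓝 (upperRelaxed f z)) := by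
  have hM' : ∀ ε z, |-f ε z| ≤ M := fun ε z => by rw [abs_neg]; exact hM ε z
  refine tendsto_order.mpr ⟨fun b hb => ?_, fun b hb => eventually_lt_of_upperRelaxed_lt hM hb⟩
  filter_upwards [eventually_lt_of_upperRelaxed_lt hM' (lt_neg_of_lt_neg (hb.trans_le h))]
    with p hp
  linarith

end Topological

/-- A scheme that strictly decreases `φ` cannot touch `φ` from below in the limit. -/
theorem false_of_scheme_of_strict_max [PseudoMetricSpace X] [ProperSpace X] {f : ℝ → X → ℝ}
    {M : ℝ} (hM : ∀ ε z, |f ε z| ≤ M) {φ : X → ℝ} {z₀ : X} {r r' b : ℝ} (hr' : 0 < r')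
    (hr : r' < r) (hφ : ContinuousOn φ (Metric.closedBall z₀ r))
    (hb₀ : b < upperRelaxed f z₀ - φ z₀)
    (hb : ∀ z ∈ Metric.closedBall z₀ r, r' ≤ dist z z₀ → upperRelaxed f z - φ z < b)
    (hs : ∀ᶠ ε in 𝓝[>] (0 : ℝ), ∃ κ > 0, ∀ z, dist z z₀ < r' → ∀ m,
      (∀ z' ∈ Metric.closedBall z₀ r, f ε z' ≤ φ z' + m) → f ε z ≤ φ z + m - κ) : False := by
  set B := Metric.closedBall z₀ r
  have hBc : IsCompact B := isCompact_closedBall _ _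
  have hA : IsCompact (B \ Metric.ball z₀ r') := hBc.diff Metric.isOpen_ball
  -- Compactness of the annulus turns the pointwise bound on the relaxed limit into one uniform in
  -- `z` for small `ε`.
  have h1 : ∀ᶠ ε in 𝓝 (0 : ℝ), ∀ z ∈ B \ Metric.ball z₀ r', 0 < ε → z ∈ B → f ε z - φ z < b := by
    refine hA.eventually_forall_of_forall_eventually fun z hz => ?_
    have h2 := hb z hz.1 (not_lt.mp hz.2)
    set e := (b - (upperRelaxed f z - φ z)) / 2 with he
    have h3 := eventually_lt_of_upperRelaxed_lt hM
      (show upperRelaxed f z < upperRelaxed f z + e by linarith)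
    have h4 : ∀ᶠ z' in 𝓝[B] z, φ z - e < φ z' :=
      (hφ z hz.1).eventually (lt_mem_nhds (by linarith))
    obtain ⟨P, hP, Q, hQ, hPQ⟩ := eventually_prod_iff.mp h3
    rw [nhds_prod_eq]
    refine eventually_prod_iff.mpr ⟨_, eventually_nhdsWithin_iff.mp hP, _,
      hQ.and (eventually_nhdsWithin_iff.mp h4), fun {ε} h5 {z'} h6 hε hz' => ?_⟩
    have := hPQ (h5 hε) h6.1
    have := h6.2 hz'
    dsimp only at *
    linarith
  have h2 : ∃ᶠ p : ℝ × X in 𝓝[>] 0 ×ˢ 𝓝 z₀, b + φ p.2 < f p.1 p.2 := by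
    set e := (upperRelaxed f z₀ - φ z₀ - b) / 2 with he
    have h3 := frequently_lt_of_lt_upperRelaxed hM
      (show upperRelaxed f z₀ - e < upperRelaxed f z₀ by linarith)
    have h4 : ∀ᶠ z' in 𝓝 z₀, φ z' < φ z₀ + e :=
      (hφ.continuousAt (Metric.closedBall_mem_nhds z₀ (hr'.trans hr))).eventually
        (gt_mem_nhds (by linarith))
    refine (h3.and_eventually (h4.prod_inr (𝓝[>] (0 : ℝ)))).mono fun p hp => ?_
    linarith [hp.1, hp.2]
  have h3 : ∀ᶠ z in 𝓝 z₀, z ∈ B := Metric.closedBall_mem_nhds z₀ (hr'.trans hr)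
  have h4 := ((hs.and ((eventually_nhdsWithin_of_eventually_nhds h1).and
    self_mem_nhdsWithin)).prod_inl (𝓝 z₀)).and (h3.prod_inr (𝓝[>] (0 : ℝ)))
  obtain ⟨⟨ε, z⟩, h5, ⟨⟨κ, hκ, hsch⟩, hann, hε⟩, hzB⟩ := (h2.and_eventually h4).exists
  dsimp only at h5 hzB hann hε hsch
  obtain ⟨m₀, hm₀⟩ := (hBc.image_of_continuousOn hφ).bddBelow
  have hbdd : BddAbove ((fun z => f ε z - φ z) '' B) := by
    refine ⟨M - m₀, ?_⟩
    rintro _ ⟨z', hz', rfl⟩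
    have := hm₀ ⟨z', hz', rfl⟩
    have := (abs_le.mp (hM ε z')).2
    dsimp only
    linarith
  set m := sSup ((fun z => f ε z - φ z) '' B)
  have hle : ∀ z' ∈ B, f ε z' ≤ φ z' + m := fun z' hz' => by
    have : f ε z' - φ z' ≤ m := le_csSup hbdd ⟨z', hz', rfl⟩
    linarith
  have hbm : b < m := by
    have := hle z hzB
    linarith
  -- `f ε` need not be semicontinuous, so the supremum `m` may not be attained. A point above both
  -- `b` and `m - κ` suffices: the first excludes the annulus, the second contradicts the scheme in
  -- the inner ball.
  obtain ⟨_, ⟨z₁, hz₁, rfl⟩, hlt⟩ := exists_lt_of_lt_csSup (⟨_, z, hzB, rfl⟩ :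
    ((fun z => f ε z - φ z) '' B).Nonempty) (show max b (m - κ) < m from max_lt hbm (by linarith))
  have hlt' := max_lt_iff.mp hlt
  by_cases hz₁r : dist z₁ z₀ < r'
  · have := hsch z₁ hz₁r m hle
    linarith [hlt'.2]
  · have := hann z₁ ⟨hz₁, hz₁r⟩ hε hz₁
    linarith [hlt'.1]

end Relaxed

/-! ### Moves, dynamic programming and the terminal layer -/

section Game

variable {N : ℕ}

theorem moveSet_nonempty (ε : ℝ) (w : EuclideanSpace ℝ (Fin N) → ℝ)
    (x : EuclideanSpace ℝ (Fin N)) : (moveSet ε w x).Nonempty := by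
  unfold moveSet
  split_ifs with h
  · exact h
  · exact singleton_nonempty x

theorem dist_lt_of_mem_moveSet {ε : ℝ} (hε : 0 < ε) {w : EuclideanSpace ℝ (Fin N) → ℝ}
    {x y : EuclideanSpace ℝ (Fin N)} (hy : y ∈ moveSet ε w x) : dist y x < ε := by
  unfold moveSet at hy
  split_ifs at hy with h
  · exact hy.1
  · rw [mem_singleton_iff.mp hy, dist_self]
    exact hε

theorem moveTime_pos {ε : ℝ} (hε : 0 < ε) (w : EuclideanSpace ℝ (Fin N) → ℝ)
    (x y : EuclideanSpace ℝ (Fin N)) : 0 < moveTime ε w x y :=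
  (minStep_pos hε).trans_le (minStep_le_moveTime ε w x y)

theorem moveTime_le {ε : ℝ} (hε : 0 < ε) (hε1 : ε ≤ 1) (w : EuclideanSpace ℝ (Fin N) → ℝ)
    (x y : EuclideanSpace ℝ (Fin N)) : moveTime ε w x y ≤ √ε := by
  rw [Real.sqrt_eq_rpow]
  unfold moveTime
  split_ifs
  · exact min_le_right _ _
  · rw [← Real.rpow_natCast]
    exact Real.rpow_le_rpow_of_exponent_ge hε hε1 (by norm_num)

theorem moveSet_of_nonpos {ε : ℝ} {w : EuclideanSpace ℝ (Fin N) → ℝ}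
    {x : EuclideanSpace ℝ (Fin N)} (h : ∀ y ∈ Metric.ball x ε, w y ≤ 0) :
    moveSet ε w x = {x} := by
  unfold moveSet
  rw [if_neg]
  rintro ⟨y, h1, h2⟩
  exact absurd h2 (not_lt.mpr (h y h1))

theorem moveTime_of_nonpos {ε : ℝ} {w : EuclideanSpace ℝ (Fin N) → ℝ}
    {x : EuclideanSpace ℝ (Fin N)} (h : ∀ y ∈ Metric.ball x ε, w y ≤ 0)
    (y : EuclideanSpace ℝ (Fin N)) : moveTime ε w x y = ε ^ 2 := by
  unfold moveTime
  rw [if_neg]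
  rintro ⟨y, h1, h2⟩
  exact absurd h2 (not_lt.mpr (h y h1))

theorem mem_moveSet_of_pos {ε : ℝ} {w : EuclideanSpace ℝ (Fin N) → ℝ}
    {x y : EuclideanSpace ℝ (Fin N)} (hy : y ∈ Metric.ball x ε) (hw : 0 < w y) :
    y ∈ moveSet ε w x := by
  unfold moveSet
  rw [if_pos ⟨y, hy, hw⟩]
  exact ⟨hy, hw⟩

/-- The cut-off is inactive at moderate speeds. -/
theorem moveTime_of_pos {ε : ℝ} (hε : 0 < ε) {w : EuclideanSpace ℝ (Fin N) → ℝ}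
    {x y : EuclideanSpace ℝ (Fin N)} (hy : y ∈ Metric.ball x ε) (hw : 0 < w y)
    (h1 : √ε ≤ w y) (h2 : w y * √ε ≤ 1) : moveTime ε w x y = ε / w y := by
  unfold moveTime
  rw [if_pos ⟨y, hy, hw⟩, posPart_eq_self.mpr hw.le, ← div_eq_mul_inv]
  unfold cutoff
  have hs : √ε * √ε = ε := Real.mul_self_sqrt hε.le
  have h3 : ε ^ (3 / 2 : ℝ) = ε * √ε := by
    rw [Real.sqrt_eq_rpow, ← Real.rpow_one_add' hε.le (by norm_num)]
    norm_num
  rw [h3, ← Real.sqrt_eq_rpow, max_eq_left, min_eq_left]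
  · rw [div_le_iff₀ hw]
    exact hs.symm.trans_le (mul_le_mul_of_nonneg_left h1 (Real.sqrt_nonneg _))
  · rw [le_div_iff₀ hw]
    nlinarith

/-- A player who moves to `y` travels at most at speed `max (w y) √ε`. -/
theorem dist_le_mul_moveTime {ε σ : ℝ} (hε : 0 < ε) {w : EuclideanSpace ℝ (Fin N) → ℝ}
    {x y : EuclideanSpace ℝ (Fin N)} (hy : y ∈ moveSet ε w x) (h1 : w y ≤ σ) (h2 : √ε ≤ σ) :
    dist y x ≤ σ * moveTime ε w x y := by
  have hs : √ε * √ε = ε := Real.mul_self_sqrt hε.le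
  have hσ : 0 < σ := (Real.sqrt_pos.mpr hε).trans_le h2
  by_cases h : (Metric.ball x ε ∩ {z | 0 < w z}).Nonempty
  · unfold moveSet at hy
    rw [if_pos h] at hy
    have hw : 0 < w y := hy.2
    unfold moveTime
    rw [if_pos h, posPart_eq_self.mpr hw.le, ← div_eq_mul_inv]
    unfold cutoff
    rw [← Real.sqrt_eq_rpow]
    -- The lower truncation only slows the player down; the upper one, `√ε`, amounts to speed `√ε ≤
    -- σ`.
    have h3 : ε / σ ≤ min (max (ε / w y) (ε ^ (3 / 2 : ℝ))) (√ε) := by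
      refine le_min (le_max_of_le_left (div_le_div_of_nonneg_left hε.le hw h1)) ?_
      rw [div_le_iff₀ hσ]
      calc ε = √ε * √ε := hs.symm
        _ ≤ √ε * σ := mul_le_mul_of_nonneg_left h2 (Real.sqrt_nonneg _)
    calc dist y x ≤ ε := hy.1.le
      _ = σ * (ε / σ) := by field_simp
      _ ≤ _ := mul_le_mul_of_nonneg_left h3 hσ.le
  · unfold moveSet at hy
    rw [if_neg h] at hy
    rw [mem_singleton_iff.mp hy, dist_self]
    exact mul_nonneg hσ.le (moveTime_pos hε w x x).le

variable {v uT : EuclideanSpace ℝ (Fin N) → ℝ} {T ε t : ℝ} {x : EuclideanSpace ℝ (Fin N)}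

theorem gameValue_of_le (h : T ≤ t) : gameValue v uT T ε t x = uT x := by
  rw [gameValue, dif_pos (Or.inl h)]

theorem gameValue_of_nonpos (h : ε ≤ 0) : gameValue v uT T ε t x = uT x := by
  rw [gameValue, dif_pos (Or.inr h)]

theorem gameValue_of_lt (h : t < T) (hε : 0 < ε) : gameValue v uT T ε t x =
    ⨆ xP : moveSet ε v x, ⨅ xC : moveSet ε (-v) (xP : EuclideanSpace ℝ (Fin N)),
      gameValue v uT T ε
        (t + moveTime ε v x xP + moveTime ε (-v) (xP : EuclideanSpace ℝ (Fin N)) xC) xC := by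
  rw [gameValue, dif_neg (not_or.mpr ⟨not_le.mpr h, not_le.mpr hε⟩)]

/-- A set of positions that no move leaves bounds the value of the game. -/
theorem gameValue_mem_Icc_of_invariant (hε : 0 < ε) {S : Set (ℝ × EuclideanSpace ℝ (Fin N))}
    {lo hi : ℝ}
    (hS : ∀ t x, (t, x) ∈ S → t < T → ∀ xP ∈ moveSet ε v x, ∀ xC ∈ moveSet ε (-v) xP,
      (t + moveTime ε v x xP + moveTime ε (-v) xP xC, xC) ∈ S)
    (hend : ∀ t x, (t, x) ∈ S → T ≤ t → uT x ∈ Icc lo hi) (h : (t, x) ∈ S) :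
    gameValue v uT T ε t x ∈ Icc lo hi := by
  -- The induction runs on an upper bound for the number of remaining rounds.
  induction hn : ⌈(T - t) / minStep ε⌉₊ using Nat.strong_induction_on generalizing t x with
  | _ n ih =>
  by_cases ht : T ≤ t
  · rw [gameValue_of_le ht]
    exact hend t x h ht
  push Not at ht
  have key : ∀ xP ∈ moveSet ε v x, ∀ xC ∈ moveSet ε (-v) xP, gameValue v uT T ε
      (t + moveTime ε v x xP + moveTime ε (-v) xP xC) xC ∈ Icc lo hi := by
    intro xP hxP xC hxC
    refine ih _ ?_ (hS t x h ht xP hxP xC hxC) rfl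
    rw [← hn]
    refine game_terminates hε ht ?_
    have := minStep_le_moveTime ε v x xP
    have := moveTime_pos hε (-v) xP xC
    linarith
  rw [gameValue_of_lt ht hε]
  have := (moveSet_nonempty ε v x).to_subtype
  have hin : ∀ xP : moveSet ε v x, (⨅ xC : moveSet ε (-v) (xP : EuclideanSpace ℝ (Fin N)),
      gameValue v uT T ε (t + moveTime ε v x xP +
        moveTime ε (-v) (xP : EuclideanSpace ℝ (Fin N)) xC) xC) ∈ Icc lo hi := by
    intro xP
    have := (moveSet_nonempty ε (-v) (xP : EuclideanSpace ℝ (Fin N))).to_subtype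
    refine ⟨le_ciInf fun xC => (key xP xP.2 xC xC.2).1, ?_⟩
    obtain ⟨xC⟩ := this
    refine (ciInf_le ⟨lo, ?_⟩ xC).trans (key xP xP.2 xC xC.2).2
    rintro _ ⟨y, rfl⟩
    exact (key xP xP.2 y y.2).1
  refine ⟨?_, ciSup_le fun xP => (hin xP).2⟩
  obtain ⟨xP⟩ := this
  refine (hin xP).1.trans (le_ciSup (f := fun xP : moveSet ε v x => ⨅ xC : moveSet ε (-v)
    (xP : EuclideanSpace ℝ (Fin N)), gameValue v uT T ε (t + moveTime ε v x xP +
        moveTime ε (-v) (xP : EuclideanSpace ℝ (Fin N)) xC) xC) ⟨hi, ?_⟩ xP)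
  rintro _ ⟨y, rfl⟩
  exact (hin y).2

theorem abs_gameValue_le {M : ℝ} (hM : ∀ x, |uT x| ≤ M) (T ε t : ℝ)
    (x : EuclideanSpace ℝ (Fin N)) : |gameValue v uT T ε t x| ≤ M := by
  rcases le_or_gt ε 0 with hε | hε
  · rw [gameValue_of_nonpos hε]
    exact hM x
  · exact abs_le.mpr (gameValue_mem_Icc_of_invariant hε (S := univ)
      (fun _ _ _ _ _ _ _ _ => mem_univ _) (fun _ x _ _ => abs_le.mp (hM x)) (mem_univ _))

/-- The bound `M` makes the families of values bounded; otherwise real `⨆` and `⨅` could take their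
default value. -/
theorem gameValue_le {M B : ℝ} (hM : ∀ x, |uT x| ≤ M) (hε : 0 < ε) (ht : t < T)
    (h : ∀ xP ∈ moveSet ε v x, ∃ xC ∈ moveSet ε (-v) xP, gameValue v uT T ε
      (t + moveTime ε v x xP + moveTime ε (-v) xP xC) xC ≤ B) :
    gameValue v uT T ε t x ≤ B := by
  rw [gameValue_of_lt ht hε]
  have := (moveSet_nonempty ε v x).to_subtype
  refine ciSup_le fun xP => ?_
  obtain ⟨xC, hxC, hle⟩ := h xP xP.2
  refine (ciInf_le ⟨-M, ?_⟩ (⟨xC, hxC⟩ : moveSet ε (-v) (xP : EuclideanSpace ℝ (Fin N)))).trans hle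
  rintro _ ⟨y, rfl⟩
  exact (abs_le.mp (abs_gameValue_le hM _ _ _ _)).1

theorem le_gameValue {M B : ℝ} (hM : ∀ x, |uT x| ≤ M) (hε : 0 < ε) (ht : t < T)
    (h : ∃ xP ∈ moveSet ε v x, ∀ xC ∈ moveSet ε (-v) xP, B ≤ gameValue v uT T ε
      (t + moveTime ε v x xP + moveTime ε (-v) xP xC) xC) :
    B ≤ gameValue v uT T ε t x := by
  rw [gameValue_of_lt ht hε]
  obtain ⟨xP, hxP, hle⟩ := h
  have := (moveSet_nonempty ε (-v) xP).to_subtype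
  refine (le_ciInf fun xC : moveSet ε (-v) xP => hle xC xC.2).trans
    (le_ciSup (f := fun xP : moveSet ε v x => ⨅ xC : moveSet ε (-v)
    (xP : EuclideanSpace ℝ (Fin N)), gameValue v uT T ε (t + moveTime ε v x xP +
        moveTime ε (-v) (xP : EuclideanSpace ℝ (Fin N)) xC) xC) ⟨M, ?_⟩ ⟨xP, hxP⟩)
  rintro _ ⟨y, rfl⟩
  obtain ⟨yC, hyC⟩ := moveSet_nonempty ε (-v) (y : EuclideanSpace ℝ (Fin N))
  refine (ciInf_le ⟨-M, ?_⟩ (⟨yC, hyC⟩ : moveSet ε (-v) (y : EuclideanSpace ℝ (Fin N)))).trans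
    (abs_le.mp (abs_gameValue_le hM _ _ _ _)).2
  rintro _ ⟨z, rfl⟩
  exact (abs_le.mp (abs_gameValue_le hM _ _ _ _)).1

/-- Growth of the distance to `x₀` along one move. -/
theorem growth_of_move (hε : 0 < ε) (hε1 : ε ≤ 1) {w : EuclideanSpace ℝ (Fin N) → ℝ}
    {x₀ y : EuclideanSpace ℝ (Fin N)} {A L : ℝ} (hA : 0 ≤ A) (hL : 0 ≤ L)
    (hw : ∀ z, w z ≤ A + L * dist z x₀) (hy : y ∈ moveSet ε w x) :
    A + L + 1 + L * dist y x₀ ≤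
      (A + L + 1 + L * dist x x₀) * Real.exp (L * moveTime ε w x y) := by
  have hd := dist_lt_of_mem_moveSet hε hy
  have htri := dist_triangle y x x₀
  have hx0 : 0 ≤ dist x x₀ := dist_nonneg
  -- The term `L` absorbs the growth of the speed over a step of length `ε ≤ 1`, and the `1`
  -- dominates `√ε`.
  have h1 : dist y x ≤ (A + L + 1 + L * dist x x₀) * moveTime ε w x y := by
    refine dist_le_mul_moveTime hε hy ((hw y).trans ?_) ?_
    · nlinarith
    · have : √ε ≤ 1 := Real.sqrt_le_one.mpr hε1
      nlinarith [mul_nonneg hL hx0]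
  have h2 := Real.add_one_le_exp (L * moveTime ε w x y)
  have h3 : 0 ≤ A + L + 1 + L * dist x x₀ := by positivity
  nlinarith [mul_le_mul_of_nonneg_left h2 h3, mul_le_mul_of_nonneg_left h1 hL,
    mul_le_mul_of_nonneg_left htri hL]

/-- Discrete Gronwall: `(A + L + 1 + L d) * exp (L (T' - s))`, with `d` the distance to `x₀` and `s`
the current time, does not increase along the game. Here `T'` bounds every end time, since the last
round starts before `T` and lasts at most `2√ε`. With `L ≥ 1` the final distance is then controlled,
and the Lipschitz bound on `uT` applies. -/
theorem abs_gameValue_sub_le (hε : 0 < ε) (hε1 : ε ≤ 1) {Lu : NNReal} (huT : LipschitzWith Lu uT)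
    {x₀ : EuclideanSpace ℝ (Fin N)} {A L : ℝ} (hA : 0 ≤ A) (hL : 1 ≤ L)
    (hv : ∀ z, |v z| ≤ A + L * dist z x₀) (t : ℝ) (x : EuclideanSpace ℝ (Fin N)) :
    |gameValue v uT T ε t x - uT x₀| ≤ Lu * ((A + L + 1 + L * dist x x₀) *
      Real.exp (L * (max t (T + 2 * √ε) - t)) - (A + L + 1)) := by
  set T' := max t (T + 2 * √ε)
  set K := (A + L + 1 + L * dist x x₀) * Real.exp (L * (T' - t)) with hK
  have hL0 : 0 ≤ L := by linarith
  suffices h : gameValue v uT T ε t x ∈ Icc (uT x₀ - Lu * (K - (A + L + 1)))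
      (uT x₀ + Lu * (K - (A + L + 1))) by
    rw [abs_le]
    constructor <;> linarith [h.1, h.2]
  refine gameValue_mem_Icc_of_invariant hε (S := {p | p.1 ≤ T' ∧
    (A + L + 1 + L * dist p.2 x₀) * Real.exp (L * (T' - p.1)) ≤ K}) ?_ ?_ ?_
  · rintro s y ⟨-, hs⟩ hsT xP hxP xC hxC
    have h1 := growth_of_move hε hε1 hA hL0 (fun z => (le_abs_self _).trans (hv z)) hxP
    have h2 := growth_of_move (w := -v) hε hε1 hA hL0 (fun z => (neg_le_abs _).trans (hv z)) hxC
    have h3 := moveTime_le hε hε1 v y xP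
    have h4 := moveTime_le hε hε1 (-v) xP xC
    refine ⟨le_max_of_le_right (by linarith), le_trans ?_ hs⟩
    dsimp only
    set τ := moveTime ε v y xP
    set τ' := moveTime ε (-v) xP xC
    calc _ ≤ (A + L + 1 + L * dist y x₀) * Real.exp (L * τ) * Real.exp (L * τ') *
          Real.exp (L * (T' - (s + τ + τ'))) := by
          gcongr
          exact h2.trans (by gcongr)
      _ = _ := by
          rw [mul_assoc, mul_assoc, ← Real.exp_add, ← Real.exp_add]
          ring_nf
  · rintro s y ⟨hs1, hs2⟩ -
    dsimp only at hs1 hs2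
    have h1 : 1 ≤ Real.exp (L * (T' - s)) := Real.one_le_exp (mul_nonneg hL0 (by linarith))
    have hd : 0 ≤ dist y x₀ := dist_nonneg
    have h2 : A + L + 1 + dist y x₀ ≤ K := by
      have : 0 ≤ A + L + 1 + L * dist y x₀ := by positivity
      nlinarith
    have h3 := huT.dist_le_mul y x₀
    rw [Real.dist_eq] at h3
    have h4 : Lu * dist y x₀ ≤ Lu * (K - (A + L + 1)) :=
      mul_le_mul_of_nonneg_left (by linarith) Lu.2
    have h5 := abs_le.mp (h3.trans h4)
    constructor <;> linarith [h5.1, h5.2]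
  · exact ⟨le_max_left _ _, le_rfl⟩

theorem tendsto_gameValue_terminal {L Lu : NNReal} (hv : LipschitzWith L v)
    (huT : LipschitzWith Lu uT) (T : ℝ) (x₀ : EuclideanSpace ℝ (Fin N)) :
    Tendsto (fun p : ℝ × (ℝ × EuclideanSpace ℝ (Fin N)) => gameValue v uT T p.1 p.2.1 p.2.2)
      (𝓝[>] 0 ×ˢ 𝓝 (T, x₀)) (𝓝 (uT x₀)) := by
  set A := |v x₀|
  set L' : ℝ := L + 1
  have hL' : 1 ≤ L' := by simp [L']
  have hvb : ∀ z, |v z| ≤ A + L' * dist z x₀ := by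
    intro z
    have h1 := hv.dist_le_mul z x₀
    rw [Real.dist_eq] at h1
    have h2 := abs_sub_abs_le_abs_sub (v z) (v x₀)
    have h3 : 0 ≤ dist z x₀ := dist_nonneg
    simp only [L', A]
    linarith
  set G : ℝ × (ℝ × EuclideanSpace ℝ (Fin N)) → ℝ := fun p =>
    Lu * ((A + L' + 1 + L' * dist p.2.2 x₀) *
      Real.exp (L' * (max p.2.1 (T + 2 * √p.1) - p.2.1)) - (A + L' + 1))
  have hG : Continuous G := by fun_prop
  have hG0 : G (0, (T, x₀)) = 0 := by simp [G]
  have hGt : Tendsto G (𝓝[>] 0 ×ˢ 𝓝 (T, x₀)) (𝓝 0) := by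
    have := hG.tendsto (0, (T, x₀))
    rw [hG0, nhds_prod_eq] at this
    exact this.mono_left (prod_mono_left _ nhdsWithin_le_nhds)
  rw [tendsto_iff_dist_tendsto_zero]
  refine tendsto_of_tendsto_of_tendsto_of_le_of_le' tendsto_const_nhds hGt
    (Eventually.of_forall fun _ => dist_nonneg) ?_
  have h1 : ∀ᶠ ε in 𝓝[>] (0 : ℝ), 0 < ε ∧ ε ≤ 1 :=
    (eventually_nhdsWithin_iff.mpr (Eventually.of_forall fun _ h => h)).and
      (eventually_nhdsWithin_of_eventually_nhds (Iic_mem_nhds one_pos))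
  filter_upwards [h1.prod_inl (𝓝 (T, x₀))] with p hp
  rw [Real.dist_eq]
  exact abs_gameValue_sub_le hp.1 hp.2 huT (abs_nonneg _) hL' hvb _ _

end Game

/-! ### Consistency of the game with the equation -/

section Consistency

variable {N : ℕ}

/-- First-order upper expansion of `φ` at `z₀`, uniform in pairs of points near `z₀`, with time
derivative `a` and spatial gradient `g`. -/
def HasFirstOrderBound (φ : ℝ × EuclideanSpace ℝ (Fin N) → ℝ)
    (z₀ : ℝ × EuclideanSpace ℝ (Fin N)) (a : ℝ) (g : EuclideanSpace ℝ (Fin N)) : Prop :=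
  ∀ η > 0, ∃ ρ > 0, ∀ z z', dist z z₀ < ρ → dist z' z₀ < ρ →
    φ z' ≤ φ z + a * (z'.1 - z.1) + inner ℝ g (z'.2 - z.2) + η * (|z'.1 - z.1| + ‖z'.2 - z.2‖)

/-- Strict differentiability is needed because rounds start at points near `z₀`, not at `z₀` itself.
-/
theorem hasFirstOrderBound_of_hasStrictFDerivAt {φ : ℝ × EuclideanSpace ℝ (Fin N) → ℝ}
    {φ' : ℝ × EuclideanSpace ℝ (Fin N) →L[ℝ] ℝ} {z₀ : ℝ × EuclideanSpace ℝ (Fin N)} {a : ℝ}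
    {g : EuclideanSpace ℝ (Fin N)} (h : HasStrictFDerivAt φ φ' z₀)
    (hφ' : ∀ s y, φ' (s, y) = a * s + inner ℝ g y) : HasFirstOrderBound φ z₀ a g := by
  intro η hη
  obtain ⟨ρ, hρ, H⟩ := Metric.eventually_nhds_iff.mp (h.isLittleO.def hη)
  refine ⟨ρ, hρ, fun z z' hz hz' => ?_⟩
  have h1 := H (y := (z', z)) (by rw [Prod.dist_eq]; exact max_lt hz' hz)
  dsimp only at h1
  have h2 : φ' (z' - z) = a * (z'.1 - z.1) + inner ℝ g (z'.2 - z.2) := hφ' _ _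
  rw [h2, Real.norm_eq_abs] at h1
  have h3 : ‖z' - z‖ ≤ |z'.1 - z.1| + ‖z'.2 - z.2‖ := by
    rw [Prod.norm_def]
    exact max_le (le_add_of_nonneg_right (norm_nonneg _)) (le_add_of_nonneg_left (abs_nonneg _))
  have h4 := mul_le_mul_of_nonneg_left h3 hη.le
  linarith [(abs_le.mp (h1.trans h4)).2]

variable {v uT : EuclideanSpace ℝ (Fin N) → ℝ} {φ : ℝ × EuclideanSpace ℝ (Fin N) → ℝ}
  {z₀ : ℝ × EuclideanSpace ℝ (Fin N)} {a : ℝ} {g : EuclideanSpace ℝ (Fin N)}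

theorem dist_fst_le_dist (z z' : ℝ × EuclideanSpace ℝ (Fin N)) : dist z.1 z'.1 ≤ dist z z' :=
  le_max_left _ _

theorem dist_snd_le_dist (z z' : ℝ × EuclideanSpace ℝ (Fin N)) : dist z.2 z'.2 ≤ dist z z' :=
  le_max_right _ _

theorem eventually_mul_sqrt_lt (k : ℝ) {ρ : ℝ} (hρ : 0 < ρ) :
    ∀ᶠ ε in 𝓝[>] (0 : ℝ), k * √ε < ρ := by
  have h : Continuous fun ε : ℝ => k * √ε := by fun_prop
  have h0 := h.tendsto 0
  simp only [Real.sqrt_zero, mul_zero] at h0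
  exact eventually_nhdsWithin_of_eventually_nhds (h0.eventually (gt_mem_nhds hρ))

theorem eventually_pos_lt {ρ : ℝ} (hρ : 0 < ρ) : ∀ᶠ ε in 𝓝[>] (0 : ℝ), 0 < ε ∧ ε < ρ :=
  Ioo_mem_nhdsGT hρ

theorem dist_round_le {ε t : ℝ} (hε : 0 < ε) (hε1 : ε ≤ 1) {x xP xC : EuclideanSpace ℝ (Fin N)}
    (hP : xP ∈ moveSet ε v x) (hC : xC ∈ moveSet ε (-v) xP) :
    dist (t + moveTime ε v x xP + moveTime ε (-v) xP xC, xC) (t, x) ≤ 2 * √ε := by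
  have h1 := moveTime_le hε hε1 v x xP
  have h2 := moveTime_le hε hε1 (-v) xP xC
  have h3 := moveTime_pos hε v x xP
  have h4 := moveTime_pos hε (-v) xP xC
  have h5 := dist_lt_of_mem_moveSet hε hP
  have h6 := dist_lt_of_mem_moveSet hε hC
  have h7 : ε ≤ √ε := Real.le_sqrt_of_sq_le (by nlinarith)
  rw [Prod.dist_eq]
  refine max_le ?_ ?_
  · dsimp only
    rw [Real.dist_eq, abs_of_pos (by linarith)]
    linarith
  · have := dist_triangle xC xP x
    dsimp only
    linarith

/-- If `a + |v| ‖g‖ < 0` then `φ` decreases along every round. -/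
theorem forall_round_decrease (hv : Continuous v) (hφ : HasFirstOrderBound φ z₀ a g)
    (h : a + |v z₀.2| * ‖g‖ < 0) : ∃ c > 0, ∃ ρ > 0, ∀ᶠ ε in 𝓝[>] (0 : ℝ), ∀ t x,
      dist (t, x) z₀ < ρ → ∀ xP ∈ moveSet ε v x, ∀ xC ∈ moveSet ε (-v) xP,
        φ (t + moveTime ε v x xP + moveTime ε (-v) xP xC, xC) ≤ φ (t, x) - c * minStep ε := by
  obtain ⟨σ, hσ, hneg⟩ : ∃ σ, |v z₀.2| < σ ∧ a + σ * ‖g‖ < 0 := by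
    have hc : Continuous fun σ : ℝ => a + σ * ‖g‖ := by fun_prop
    have h1 : ∀ᶠ σ in 𝓝[>] |v z₀.2|, a + σ * ‖g‖ < 0 :=
      eventually_nhdsWithin_of_eventually_nhds (hc.continuousAt.eventually (gt_mem_nhds h))
    obtain ⟨σ, h2, h3⟩ := (h1.and self_mem_nhdsWithin).exists
    exact ⟨σ, h3, h2⟩
  have hσ0 : 0 < σ := (abs_nonneg _).trans_lt hσ
  -- Half of the margin is kept as the rate of decrease; the other half pays for the first-order
  -- error `η (1 + σ) = c`.
  set c := -(a + σ * ‖g‖) / 2 with hc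
  have hc0 : 0 < c := by rw [hc]; linarith
  set η := c / (1 + σ) with hη
  have hη0 : 0 < η := by positivity
  have hησ : η * (1 + σ) = c := by rw [hη]; field_simp
  obtain ⟨ρ₁, hρ₁, hexp⟩ := hφ η hη0
  obtain ⟨ρ₂, hρ₂, hvσ⟩ := Metric.eventually_nhds_iff.mp
    ((hv.abs.continuousAt (x := z₀.2)).eventually (gt_mem_nhds hσ))
  have hρ : 0 < min ρ₁ ρ₂ / 2 := by positivity
  refine ⟨c, hc0, min ρ₁ ρ₂ / 2, hρ, ?_⟩
  filter_upwards [eventually_mul_sqrt_lt 2 hρ, eventually_mul_sqrt_lt 1 hσ0,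
    eventually_pos_lt one_pos] with ε hε1 hε2 hε3 t x htx xP hxP xC hxC
  obtain ⟨hε, hεone⟩ := hε3
  rw [one_mul] at hε2
  have hd := dist_round_le (t := t) hε hεone.le hxP hxC
  have hdC : dist (t + moveTime ε v x xP + moveTime ε (-v) xP xC, xC) z₀ < min ρ₁ ρ₂ := by
    have := dist_triangle (t + moveTime ε v x xP + moveTime ε (-v) xP xC, xC) (t, x) z₀
    linarith
  have hxC₀ : dist xC z₀.2 < ρ₂ :=
    ((dist_snd_le_dist (_, _) z₀).trans_lt hdC).trans_le (min_le_right _ _)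
  have hxP₀ : dist xP z₀.2 < ρ₂ := by
    have h1 : dist x z₀.2 < min ρ₁ ρ₂ / 2 := (dist_snd_le_dist (t, x) z₀).trans_lt htx
    have h2 := dist_triangle xP x z₀.2
    have h3 := dist_lt_of_mem_moveSet hε hxP
    have h4 : ε ≤ √ε := Real.le_sqrt_of_sq_le (by nlinarith)
    have h5 := min_le_right ρ₁ ρ₂
    have h6 := Real.sqrt_nonneg ε
    linarith
  have hP := dist_le_mul_moveTime hε hxP ((le_abs_self _).trans (hvσ hxP₀).le) hε2.le
  have hC := dist_le_mul_moveTime (w := -v) hε hxC ((neg_le_abs _).trans (hvσ hxC₀).le) hε2.le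
  have hmin : minStep ε ≤ moveTime ε v x xP + moveTime ε (-v) xP xC :=
    (minStep_le_moveTime ε v x xP).trans (le_add_of_nonneg_right (moveTime_pos hε _ _ _).le)
  have hpos : 0 < moveTime ε v x xP + moveTime ε (-v) xP xC :=
    (minStep_pos hε).trans_le hmin
  have hstep := hexp (t, x) _ (htx.trans_le ((half_le_self (by positivity)).trans
    (min_le_left _ _))) (hdC.trans_le (min_le_left _ _))
  have htri := dist_triangle xC xP x
  dsimp only at hstep
  rw [add_assoc t, add_sub_cancel_left, abs_of_pos hpos] at hstep
  rw [add_assoc t]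
  set Δ := moveTime ε v x xP + moveTime ε (-v) xP xC with hΔ
  have hnorm : ‖xC - x‖ ≤ σ * Δ := by
    rw [← dist_eq_norm, hΔ, mul_add]
    linarith
  have hinner : inner ℝ g (xC - x) ≤ ‖g‖ * (σ * Δ) :=
    (real_inner_le_norm _ _).trans (mul_le_mul_of_nonneg_left hnorm (norm_nonneg _))
  have h1 := mul_le_mul_of_nonneg_left hnorm hη0.le
  have h2 : a * Δ + ‖g‖ * (σ * Δ) + η * (Δ + σ * Δ) = -c * Δ := by
    have : η * (Δ + σ * Δ) = c * Δ := by rw [← hησ]; ring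
    rw [this, hc]
    ring
  have h3 := mul_le_mul_of_nonneg_left hmin hc0.le
  linarith

/-- Where `w > 0` and `a - w ‖g‖ < 0`, the player with speed `w` has a move against the gradient
that decreases `φ`, and the other player cannot move. -/
theorem exists_move_decrease {w : EuclideanSpace ℝ (Fin N) → ℝ} (hw : Continuous w)
    (hφ : HasFirstOrderBound φ z₀ a g) (hw₀ : 0 < w z₀.2) (h : a - w z₀.2 * ‖g‖ < 0) :
    ∃ c > 0, ∃ ρ > 0, ∀ᶠ ε in 𝓝[>] (0 : ℝ), ∀ t x, dist (t, x) z₀ < ρ →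
      (∀ y, dist y x < 2 * ε → 0 < w y) ∧ ∃ y ∈ moveSet ε w x,
        φ (t + ε ^ 2 + moveTime ε w x y, y) ≤ φ (t, x) - c * minStep ε := by
  set w₀ := w z₀.2
  set c := (w₀ * ‖g‖ - a) / 2 with hc
  have hc0 : 0 < c := by rw [hc]; linarith
  -- `F (δ, ε, w y)` bounds the change of `φ` per unit of moving time `τ`, for a step of length `(1
  -- - δ) ε` against `g` with `ε = τ w y`, including the opponent's idle time `ε²` and the expansion
  -- error. At `(0, 0, w₀)` it equals `-2c`.
  set F : ℝ × ℝ × ℝ → ℝ := fun q =>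
    a * (1 + q.2.1 * q.2.2) - (1 - q.1) * q.2.2 * ‖g‖ + q.1 * (1 + q.2.1 * q.2.2 + q.2.2)
  have hF : Continuous F := by fun_prop
  have hF0 : F (0, 0, w₀) < -c := by
    simp only [F, hc]
    linarith
  obtain ⟨δ₀, hδ₀, hFδ⟩ := Metric.eventually_nhds_iff.mp
    ((hF.continuousAt (x := (0, 0, w₀))).eventually (gt_mem_nhds hF0))
  set δ := min (δ₀ / 2) (1 / 2)
  have hδ : 0 < δ := by positivity
  have hδ1 : δ ≤ 1 / 2 := min_le_right _ _
  have hδ2 : δ < δ₀ := (min_le_left _ _).trans_lt (half_lt_self hδ₀)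
  obtain ⟨ρ₁, hρ₁, hexp⟩ := hφ δ hδ
  obtain ⟨ρ₂, hρ₂, hwρ⟩ := Metric.continuousAt_iff.mp (hw.continuousAt (x := z₀.2))
    (min δ₀ (w₀ / 2)) (by positivity)
  have hρ : 0 < min ρ₁ ρ₂ / 2 := by positivity
  refine ⟨c, hc0, min ρ₁ ρ₂ / 2, hρ, ?_⟩
  filter_upwards [eventually_mul_sqrt_lt 2 hρ, eventually_mul_sqrt_lt 1 (half_pos hw₀),
    eventually_mul_sqrt_lt (2 * w₀) one_pos, eventually_pos_lt one_pos, eventually_pos_lt hδ₀]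
    with ε hε1 hε2 hε3 hε4 hε5 t x htx
  obtain ⟨hε, hεone⟩ := hε4
  rw [one_mul] at hε2
  have hsε : ε ≤ √ε := Real.le_sqrt_of_sq_le (by nlinarith)
  have hx₀ : dist x z₀.2 < min ρ₁ ρ₂ / 2 := (dist_snd_le_dist (t, x) z₀).trans_lt htx
  have hclose : ∀ y, dist y x < 2 * ε → |w y - w₀| < min δ₀ (w₀ / 2) := by
    intro y hy
    have h1 := dist_triangle y x z₀.2
    have h2 := min_le_right ρ₁ ρ₂
    have := hwρ (x := y) (by linarith)
    rwa [Real.dist_eq] at this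
  have hwpos : ∀ y, dist y x < 2 * ε → w₀ / 2 < w y := by
    intro y hy
    have := (abs_lt.mp ((hclose y hy).trans_le (min_le_right _ _))).1
    linarith
  -- Radius `2ε` contains the opponent's ball around `x` and also around the new point, so the
  -- result serves both orders of play.
  refine ⟨fun y hy => (half_pos hw₀).trans (hwpos y hy), ?_⟩
  -- The factor `1 - δ` keeps `y` in the open ball. If `g = 0`, the convention `0⁻¹ = 0` gives `y =
  -- x`.
  set y := x - ((1 - δ) * ε) • (‖g‖⁻¹ • g) with hy
  have hunit : ‖‖g‖⁻¹ • g‖ ≤ 1 := by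
    rw [norm_smul, norm_inv, norm_norm]
    exact inv_mul_le_one
  have hθ : 0 ≤ (1 - δ) * ε := mul_nonneg (by linarith) hε.le
  have hyx : y - x = -(((1 - δ) * ε) • (‖g‖⁻¹ • g)) := by rw [hy]; abel
  have hnorm : ‖y - x‖ ≤ (1 - δ) * ε := by
    rw [hyx, norm_neg, norm_smul, Real.norm_of_nonneg hθ]
    exact mul_le_of_le_one_right hθ hunit
  have hnlt : ‖y - x‖ < ε := by nlinarith
  have hinner : inner ℝ g (y - x) = -((1 - δ) * ε * ‖g‖) := by
    rw [hyx, inner_neg_right, inner_smul_right, inner_smul_right, real_inner_self_eq_norm_sq]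
    rcases eq_or_ne ‖g‖ 0 with h0 | h0
    · simp [h0]
    · field_simp
  have hyball : y ∈ Metric.ball x ε := by rwa [Metric.mem_ball, dist_eq_norm]
  have hy2 : dist y x < 2 * ε := by rw [dist_eq_norm]; linarith
  have hWpos : 0 < w y := (half_pos hw₀).trans (hwpos y hy2)
  have hW := abs_lt.mp ((hclose y hy2).trans_le (min_le_right _ _))
  have hym := mem_moveSet_of_pos hyball hWpos
  have hsn := Real.sqrt_nonneg ε
  have hτ := moveTime_of_pos hε hyball hWpos (by linarith) (by nlinarith)
  have hmin := minStep_le_moveTime ε w x y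
  have hτpos := moveTime_pos hε w x y
  have hτle := moveTime_le hε hεone.le w x y
  refine ⟨y, hym, ?_⟩
  set τ := moveTime ε w x y
  have hFneg := hFδ (y := (δ, ε, w y)) (by
    rw [Prod.dist_eq, Prod.dist_eq]
    refine max_lt ?_ (max_lt ?_ ?_)
    · rw [Real.dist_eq, sub_zero, abs_of_pos hδ]
      exact hδ2
    · dsimp only
      rw [Real.dist_eq, sub_zero, abs_of_pos hε]
      exact hε5.2
    · dsimp only
      rw [Real.dist_eq]
      exact (hclose y hy2).trans_le (min_le_left _ _))
  have hε2' : ε ^ 2 ≤ √ε := by nlinarith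
  have hdC : dist (t + ε ^ 2 + τ, y) (t, x) ≤ 2 * √ε := by
    rw [Prod.dist_eq]
    refine max_le ?_ ?_
    · dsimp only
      rw [Real.dist_eq, abs_of_pos (by nlinarith)]
      linarith
    · dsimp only
      linarith
  have hstep := hexp (t, x) (t + ε ^ 2 + τ, y)
    (htx.trans_le ((half_le_self (by positivity)).trans (min_le_left _ _))) (by
      have h1 := dist_triangle (t + ε ^ 2 + τ, y) (t, x) z₀
      have h2 := min_le_left ρ₁ ρ₂
      linarith)
  dsimp only at hstep
  have hΔ : t + ε ^ 2 + τ - t = ε ^ 2 + τ := by ring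
  rw [hΔ, abs_of_pos (by positivity), hinner] at hstep
  have hετ : ε = τ * w y := by rw [hτ]; field_simp
  have hI : a * (ε ^ 2 + τ) + -((1 - δ) * ε * ‖g‖) + δ * (ε ^ 2 + τ + ε) =
      τ * F (δ, ε, w y) := by
    simp only [F]
    have : ε ^ 2 = ε * (τ * w y) := by rw [← hετ]; ring
    rw [this]
    nth_rewrite 2 [hετ]
    nth_rewrite 3 [hετ]
    ring
  have h1 := mul_le_mul_of_nonneg_left hFneg.le hτpos.le
  have h2 := mul_le_mul_of_nonneg_left hmin hc0.le
  have h3 := mul_le_mul_of_nonneg_left hnlt.le hδ.le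
  linarith

/-- For `v z₀.2 ≥ 0` the hypothesis involves `|v|`, so any reply works. For `v z₀.2 < 0` Paul must
stay put and Carol steps against `g`. -/
theorem forall_exists_round_decrease (hv : Continuous v) (hφ : HasFirstOrderBound φ z₀ a g)
    (h : a + v z₀.2 * ‖g‖ < 0) : ∃ c > 0, ∃ ρ > 0, ∀ᶠ ε in 𝓝[>] (0 : ℝ), ∀ t x,
      dist (t, x) z₀ < ρ → ∀ xP ∈ moveSet ε v x, ∃ xC ∈ moveSet ε (-v) xP,
        φ (t + moveTime ε v x xP + moveTime ε (-v) xP xC, xC) ≤ φ (t, x) - c * minStep ε := by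
  rcases le_or_gt 0 (v z₀.2) with h0 | h0
  · obtain ⟨c, hc, ρ, hρ, H⟩ := forall_round_decrease hv hφ (by rwa [abs_of_nonneg h0])
    refine ⟨c, hc, ρ, hρ, H.mono fun ε H t x htx xP hxP => ?_⟩
    obtain ⟨xC, hxC⟩ := moveSet_nonempty ε (-v) xP
    exact ⟨xC, hxC, H t x htx xP hxP xC hxC⟩
  · obtain ⟨c, hc, ρ, hρ, H⟩ := exists_move_decrease (w := -v) hv.neg hφ (by simpa using h0)
      (by simpa using h)
    refine ⟨c, hc, ρ, hρ, ?_⟩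
    filter_upwards [H, self_mem_nhdsWithin] with ε H hε t x htx xP hxP
    obtain ⟨h1, y, hy, hle⟩ := H t x htx
    have hε' : 0 < ε := hε
    have hstuck : ∀ y ∈ Metric.ball x ε, v y ≤ 0 := fun y hy => by
      have : 0 < -v y := h1 y (by linarith [Metric.mem_ball.mp hy])
      linarith
    rw [moveSet_of_nonpos hstuck, mem_singleton_iff] at hxP
    subst hxP
    rw [moveTime_of_nonpos hstuck]
    exact ⟨y, hy, hle⟩

theorem exists_forall_round_decrease (hv : Continuous v) (hφ : HasFirstOrderBound φ z₀ a g)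
    (h : a - v z₀.2 * ‖g‖ < 0) : ∃ c > 0, ∃ ρ > 0, ∀ᶠ ε in 𝓝[>] (0 : ℝ), ∀ t x,
      dist (t, x) z₀ < ρ → ∃ xP ∈ moveSet ε v x, ∀ xC ∈ moveSet ε (-v) xP,
        φ (t + moveTime ε v x xP + moveTime ε (-v) xP xC, xC) ≤ φ (t, x) - c * minStep ε := by
  rcases le_or_gt (v z₀.2) 0 with h0 | h0
  · obtain ⟨c, hc, ρ, hρ, H⟩ := forall_round_decrease hv hφ (by
      rwa [abs_of_nonpos h0, neg_mul, ← sub_eq_add_neg])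
    refine ⟨c, hc, ρ, hρ, H.mono fun ε H t x htx => ?_⟩
    obtain ⟨xP, hxP⟩ := moveSet_nonempty ε v x
    exact ⟨xP, hxP, H t x htx xP hxP⟩
  · obtain ⟨c, hc, ρ, hρ, H⟩ := exists_move_decrease hv hφ h0 h
    refine ⟨c, hc, ρ, hρ, ?_⟩
    filter_upwards [H, self_mem_nhdsWithin] with ε H hε t x htx
    obtain ⟨h1, y, hy, hle⟩ := H t x htx
    refine ⟨y, hy, fun xC hxC => ?_⟩
    have hyx := dist_lt_of_mem_moveSet hε hy
    have hstuck : ∀ z ∈ Metric.ball y ε, (-v) z ≤ 0 := fun z hz => by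
      have h2 := dist_triangle z y x
      have : 0 < v z := h1 z (by linarith [Metric.mem_ball.mp hz])
      simpa using this.le
    rw [moveSet_of_nonpos hstuck, mem_singleton_iff] at hxC
    subst hxC
    rw [moveTime_of_nonpos hstuck, add_right_comm]
    exact hle

/-- Dynamic programming turns decrease along a round into decrease of the scheme; one round reaches
no farther than `2√ε` in space-time. -/
theorem gameValue_le_of_test {M T : ℝ} (hM : ∀ x, |uT x| ≤ M) (hv : Continuous v)
    (hT : z₀.1 < T) (hφ : HasFirstOrderBound φ z₀ a g) (h : a + v z₀.2 * ‖g‖ < 0) :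
    ∃ c > 0, ∃ ρ > 0, ∀ᶠ ε in 𝓝[>] (0 : ℝ), ∀ z, dist z z₀ < ρ → ∀ m,
      (∀ z', dist z' z ≤ 2 * √ε → gameValue v uT T ε z'.1 z'.2 ≤ φ z' + m) →
        gameValue v uT T ε z.1 z.2 ≤ φ z + m - c * minStep ε := by
  obtain ⟨c, hc, ρ, hρ, H⟩ := forall_exists_round_decrease hv hφ h
  refine ⟨c, hc, min ρ (T - z₀.1), lt_min hρ (by linarith), ?_⟩
  filter_upwards [H, eventually_pos_lt one_pos] with ε H hε z hz m hm
  have ht : z.1 < T := by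
    have h1 : dist z.1 z₀.1 < T - z₀.1 :=
      ((dist_fst_le_dist z z₀).trans_lt hz).trans_le (min_le_right _ _)
    rw [Real.dist_eq] at h1
    linarith [le_abs_self (z.1 - z₀.1)]
  refine gameValue_le hM hε.1 ht fun xP hxP => ?_
  obtain ⟨xC, hxC, hle⟩ := H z.1 z.2 (hz.trans_le (min_le_left _ _)) xP hxP
  refine ⟨xC, hxC, ?_⟩
  have := hm _ (dist_round_le hε.1 hε.2.le hxP hxC)
  linarith

theorem neg_gameValue_le_of_test {M T : ℝ} (hM : ∀ x, |uT x| ≤ M) (hv : Continuous v)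
    (hT : z₀.1 < T) (hφ : HasFirstOrderBound φ z₀ a g) (h : a - v z₀.2 * ‖g‖ < 0) :
    ∃ c > 0, ∃ ρ > 0, ∀ᶠ ε in 𝓝[>] (0 : ℝ), ∀ z, dist z z₀ < ρ → ∀ m,
      (∀ z', dist z' z ≤ 2 * √ε → -gameValue v uT T ε z'.1 z'.2 ≤ φ z' + m) →
        -gameValue v uT T ε z.1 z.2 ≤ φ z + m - c * minStep ε := by
  obtain ⟨c, hc, ρ, hρ, H⟩ := exists_forall_round_decrease hv hφ h
  refine ⟨c, hc, min ρ (T - z₀.1), lt_min hρ (by linarith), ?_⟩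
  filter_upwards [H, eventually_pos_lt one_pos] with ε H hε z hz m hm
  have ht : z.1 < T := by
    have h1 : dist z.1 z₀.1 < T - z₀.1 :=
      ((dist_fst_le_dist z z₀).trans_lt hz).trans_le (min_le_right _ _)
    rw [Real.dist_eq] at h1
    linarith [le_abs_self (z.1 - z₀.1)]
  rw [neg_le]
  obtain ⟨xP, hxP, hle⟩ := H z.1 z.2 (hz.trans_le (min_le_left _ _))
  refine le_gameValue hM hε.1 ht ⟨xP, hxP, fun xC hxC => ?_⟩
  have := hm _ (dist_round_le hε.1 hε.2.le hxP hxC)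
  have := hle xC hxC
  linarith

end Consistency

/-! ### Relaxed limits of the game values as viscosity sub- and supersolutions -/

section Convergence

variable {N : ℕ}

theorem fderiv_apply_eq_deriv_add_inner_gradient {φ : ℝ × EuclideanSpace ℝ (Fin N) → ℝ}
    {φ' : ℝ × EuclideanSpace ℝ (Fin N) →L[ℝ] ℝ} {t : ℝ} {x : EuclideanSpace ℝ (Fin N)}
    (h : HasFDerivAt φ φ' (t, x)) (s : ℝ) (y : EuclideanSpace ℝ (Fin N)) :
    φ' (s, y) = deriv (fun s => φ (s, x)) t * s + inner ℝ (gradient (fun y => φ (t, y)) x) y := by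
  have h1 : HasDerivAt (fun s => φ (s, x)) (φ' (1, 0)) t :=
    h.comp_hasDerivAt t ((hasDerivAt_id t).prodMk (hasDerivAt_const t x))
  have h2 : HasFDerivAt (fun y => φ (t, y)) (φ'.comp (ContinuousLinearMap.inr ℝ ℝ _)) x :=
    h.comp x (hasFDerivAt_prodMk_right t x)
  rw [h1.deriv, gradient, h2.fderiv, InnerProductSpace.toDual_symm_apply]
  have h3 : (s, y) = s • ((1 : ℝ), (0 : EuclideanSpace ℝ (Fin N))) + (0, y) := by
    simp
  rw [h3, map_add, map_smul]
  simp [mul_comm]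

theorem sq_dist_le_sqPen (p q : ℝ × EuclideanSpace ℝ (Fin N)) : dist p q ^ 2 ≤ sqPen p q := by
  unfold sqPen
  rw [Prod.dist_eq, Real.dist_eq, dist_eq_norm]
  rcases max_choice |p.1 - q.1| ‖p.2 - q.2‖ with h | h <;> rw [h]
  · rw [sq_abs]
    exact le_add_of_nonneg_right (sq_nonneg _)
  · exact le_add_of_nonneg_left (sq_nonneg _)

/-- If the scheme decreases all functions with derivative `φ'` at `z₀`, the upper relaxed limit
is not touched from above there by such a function. -/
theorem not_isLocalMax_of_scheme {f : ℝ → ℝ × EuclideanSpace ℝ (Fin N) → ℝ} {M : ℝ}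
    (hM : ∀ ε z, |f ε z| ≤ M) {φ : ℝ × EuclideanSpace ℝ (Fin N) → ℝ}
    {φ' : ℝ × EuclideanSpace ℝ (Fin N) →L[ℝ] ℝ} {z₀ : ℝ × EuclideanSpace ℝ (Fin N)}
    (hφ : HasStrictFDerivAt φ φ' z₀) (hcont : ∀ᶠ z in 𝓝 z₀, ContinuousAt φ z)
    (H : ∀ ψ : ℝ × EuclideanSpace ℝ (Fin N) → ℝ, HasStrictFDerivAt ψ φ' z₀ →
      ∃ c > 0, ∃ ρ > 0, ∀ᶠ ε in 𝓝[>] (0 : ℝ), ∀ z, dist z z₀ < ρ → ∀ m,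
        (∀ z', dist z' z ≤ 2 * √ε → f ε z' ≤ ψ z' + m) → f ε z ≤ ψ z + m - c * minStep ε) :
    ¬IsLocalMax (fun p => upperRelaxed f p - φ p) z₀ := by
  intro hmax
  -- The added square makes the maximum strict and leaves the derivative at `z₀` unchanged, which is
  -- why `H` is assumed for all `ψ` with derivative `φ'`.
  set ψ : ℝ × EuclideanSpace ℝ (Fin N) → ℝ := fun p => φ p + sqPen p z₀
  have hpen : HasStrictFDerivAt (fun p => sqPen p z₀)
      (0 : ℝ × EuclideanSpace ℝ (Fin N) →L[ℝ] ℝ) z₀ := by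
    have h1 := ((contDiff_sqPen z₀).contDiffAt (x := z₀)).hasStrictFDerivAt (by norm_num)
    have h2 : IsLocalMin (fun p => sqPen p z₀) z₀ :=
      Eventually.of_forall fun p => (sqPen_self z₀).trans_le (sqPen_nonneg p z₀)
    rwa [h2.fderiv_eq_zero] at h1
  have hψ : HasStrictFDerivAt ψ φ' z₀ := by
    have := hφ.fun_add hpen
    rwa [add_zero] at this
  obtain ⟨c, hc, ρ, hρ, hs⟩ := H ψ hψ
  obtain ⟨r₁, hr₁, hnear⟩ := Metric.eventually_nhds_iff.mp (hmax.and hcont)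
  set r := min r₁ ρ / 2
  have hr : 0 < r := by positivity
  have hrm : r < min r₁ ρ := half_lt_self (by positivity)
  have hball : ∀ z ∈ Metric.closedBall z₀ r, dist z z₀ < r₁ := fun z hz =>
    (Metric.mem_closedBall.mp hz).trans_lt (hrm.trans_le (min_le_left _ _))
  have hψ₀ : ψ z₀ = φ z₀ := by simp [ψ, sqPen_self]
  refine false_of_scheme_of_strict_max hM (φ := ψ) (z₀ := z₀) (r := r) (r' := r / 2)
    (b := upperRelaxed f z₀ - φ z₀ - (r / 2) ^ 2 / 2) (half_pos hr) (half_lt_self hr) ?_ ?_ ?_ ?_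
  · intro z hz
    have h1 := (hnear (hball z hz)).2
    have h2 := (contDiff_sqPen z₀).continuous.continuousAt (x := z)
    exact (h1.add h2).continuousWithinAt
  · rw [hψ₀]
    have : 0 < (r / 2) ^ 2 := by positivity
    linarith
  · intro z hz hrz
    have h1 := (hnear (hball z hz)).1
    have h2 := sq_dist_le_sqPen z z₀
    have h3 : (r / 2) ^ 2 ≤ dist z z₀ ^ 2 := pow_le_pow_left₀ (half_pos hr).le hrz 2
    have h4 : 0 < (r / 2) ^ 2 := by positivity
    simp only [ψ]
    linarith
  · filter_upwards [hs, eventually_mul_sqrt_lt 2 (half_pos hr), self_mem_nhdsWithin]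
      with ε hs hε hε0
    refine ⟨c * minStep ε, mul_pos hc (minStep_pos hε0), fun z hz m hm => hs z ?_ m fun z' hz' => ?_⟩
    · exact hz.trans ((half_lt_self hr).trans (hrm.trans_le (min_le_right _ _)))
    · refine hm z' (Metric.mem_closedBall.mpr ?_)
      have := dist_triangle z' z z₀
      linarith

variable {v uT : EuclideanSpace ℝ (Fin N) → ℝ} {M T : ℝ}

/-- The values of the game as functions on space-time. -/
def gameFamily (v uT : EuclideanSpace ℝ (Fin N) → ℝ) (T ε : ℝ)
    (p : ℝ × EuclideanSpace ℝ (Fin N)) : ℝ :=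
  gameValue v uT T ε p.1 p.2

theorem strip_mem_nhds {t : ℝ} (ht : t ∈ Ioo 0 T) (x : EuclideanSpace ℝ (Fin N)) :
    Ioo 0 T ×ˢ univ ∈ 𝓝 (t, x) :=
  prod_mem_nhds (Ioo_mem_nhds ht.1 ht.2) univ_mem

theorem hasStrictFDerivAt_of_contDiffOn_strip {φ : ℝ × EuclideanSpace ℝ (Fin N) → ℝ}
    (hφ : ContDiffOn ℝ 2 φ (Ioo 0 T ×ˢ univ)) {t : ℝ} (ht : t ∈ Ioo 0 T)
    (x : EuclideanSpace ℝ (Fin N)) : HasStrictFDerivAt φ (fderiv ℝ φ (t, x)) (t, x) :=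
  (hφ.contDiffAt (strip_mem_nhds ht x)).hasStrictFDerivAt (by norm_num)

theorem eventually_continuousAt_of_contDiffOn_strip {φ : ℝ × EuclideanSpace ℝ (Fin N) → ℝ}
    (hφ : ContDiffOn ℝ 2 φ (Ioo 0 T ×ˢ univ)) {t : ℝ} (ht : t ∈ Ioo 0 T)
    (x : EuclideanSpace ℝ (Fin N)) : ∀ᶠ z in 𝓝 (t, x), ContinuousAt φ z := by
  filter_upwards [eventually_mem_nhds_iff.mpr (strip_mem_nhds ht x)] with z hz
  exact (hφ.contDiffAt hz).continuousAt

theorem isViscositySubsolution_upperRelaxed (hM : ∀ x, |uT x| ≤ M) (hv : Continuous v) :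
    IsViscositySubsolution v T (upperRelaxed (gameFamily v uT T)) := by
  have hfM : ∀ ε z, |gameFamily v uT T ε z| ≤ M := fun ε z => abs_gameValue_le hM T ε z.1 z.2
  refine ⟨(upperSemicontinuous_upperRelaxed hfM).upperSemicontinuousOn _, ?_⟩
  intro φ hφ t x ht hmax
  by_contra! hlt
  have hstrict := hasStrictFDerivAt_of_contDiffOn_strip hφ ht x
  refine not_isLocalMax_of_scheme hfM hstrict (eventually_continuousAt_of_contDiffOn_strip hφ ht x)
    (fun ψ hψ => ?_) hmax
  refine gameValue_le_of_test hM hv ht.2 (hasFirstOrderBound_of_hasStrictFDerivAt hψ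
    (fderiv_apply_eq_deriv_add_inner_gradient hstrict.hasFDerivAt)) ?_
  dsimp only
  linarith

/-- The subsolution argument applied to `-u^ε` and `-φ`: the derivatives change sign, the norm of
the gradient does not. -/
theorem isViscositySupersolution_neg_upperRelaxed_neg (hM : ∀ x, |uT x| ≤ M)
    (hv : Continuous v) : IsViscositySupersolution v T
      (fun p => -upperRelaxed (fun ε z => -gameFamily v uT T ε z) p) := by
  have hfM : ∀ ε z, |-gameFamily v uT T ε z| ≤ M := fun ε z => by
    rw [abs_neg]
    exact abs_gameValue_le hM T ε z.1 z.2
  refine ⟨fun z _ y hy => ?_, ?_⟩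
  · filter_upwards [((upperSemicontinuous_upperRelaxed hfM).upperSemicontinuousOn univ).mono
      (subset_univ (Ioo 0 T ×ˢ univ)) z ‹_› (-y) (lt_neg_of_lt_neg hy)] with z' hz'
    exact lt_neg_of_lt_neg hz'
  intro φ hφ t x ht hmin
  by_contra! hlt
  have hstrict := hasStrictFDerivAt_of_contDiffOn_strip hφ ht x
  have hcont := eventually_continuousAt_of_contDiffOn_strip hφ ht x
  refine not_isLocalMax_of_scheme hfM hstrict.fun_neg (hcont.mono fun z hz => hz.neg)
    (fun ψ hψ => ?_) (hmin.mono fun p hp => by dsimp only at *; linarith)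
  refine neg_gameValue_le_of_test (a := -deriv (fun s => φ (s, x)) t)
    (g := -gradient (fun y => φ (t, y)) x) hM hv ht.2
    (hasFirstOrderBound_of_hasStrictFDerivAt hψ fun s y => ?_) ?_
  · rw [neg_apply, fderiv_apply_eq_deriv_add_inner_gradient hstrict.hasFDerivAt, inner_neg_left]
    ring
  · rw [norm_neg]
    exact hlt

end Convergence
end

/-! ### Existence, uniqueness and convergence -/

theorem theorem2 {N : ℕ} (v uT : EuclideanSpace ℝ (Fin N) → ℝ) (T : ℝ) (hT : 0 < T)
    (hv : ∃ L : NNReal, LipschitzWith L v)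
    (huT : ∃ L : NNReal, LipschitzWith L uT)
    (huT_bdd : ∃ M : ℝ, ∀ x, |uT x| ≤ M) :
    ∃ u : ℝ × EuclideanSpace ℝ (Fin N) → ℝ,
      IsTerminalViscositySolution v uT T u ∧
      (∀ w : ℝ × EuclideanSpace ℝ (Fin N) → ℝ,
        IsTerminalViscositySolution v uT T w → EqOn w u (Ioc 0 T ×ˢ univ)) ∧
      TendstoLocallyUniformlyOn
        (fun (ε : ℝ) (p : ℝ × EuclideanSpace ℝ (Fin N)) => gameValue v uT T ε p.1 p.2)
        u (𝓝[>] 0) (Ioc 0 T ×ˢ univ) := by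
  obtain ⟨L, hv⟩ := hv
  obtain ⟨Lu, huT⟩ := huT
  obtain ⟨M, hM⟩ := huT_bdd
  set f := gameFamily v uT T
  set U := upperRelaxed f
  set W := fun p => -upperRelaxed (fun ε z => -f ε z) p
  have hfM : ∀ ε z, |f ε z| ≤ M := fun ε z => abs_gameValue_le hM T ε z.1 z.2
  have hfM' : ∀ ε z, |-f ε z| ≤ M := fun ε z => by rw [abs_neg]; exact hfM ε z
  have hsub : IsViscositySubsolution v T U := isViscositySubsolution_upperRelaxed hM hv.continuous
  have hsup : IsViscositySupersolution v T W :=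
    isViscositySupersolution_neg_upperRelaxed_neg hM hv.continuous
  have hUusc : UpperSemicontinuousOn U (Ioc 0 T ×ˢ univ) :=
    (upperSemicontinuous_upperRelaxed hfM).upperSemicontinuousOn _
  have hWlsc : LowerSemicontinuousOn W (Ioc 0 T ×ˢ univ) := fun z _ y hy => by
    filter_upwards [mem_nhdsWithin_of_mem_nhds
      (upperSemicontinuous_upperRelaxed hfM' z (-y) (lt_neg_of_lt_neg hy))] with z' hz'
    exact lt_neg_of_lt_neg hz'
  have hUT : ∀ x, U (T, x) = uT x := fun x =>
    upperRelaxed_eq_of_tendsto (tendsto_gameValue_terminal hv huT T x)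
  have hWT : ∀ x, W (T, x) = uT x := fun x => by
    have := upperRelaxed_eq_of_tendsto (f := fun ε z => -f ε z)
      (tendsto_gameValue_terminal hv huT T x).neg
    simp only [W, this, neg_neg]
  have hUW : ∀ p ∈ Ioc 0 T ×ˢ (univ : Set (EuclideanSpace ℝ (Fin N))), U p ≤ W p := fun p hp =>
    viscosity_comparison hv hsub hsup hUusc hWlsc (fun x => by rw [hUT, hWT]) hp
  have heq : ∀ p ∈ Ioc 0 T ×ˢ (univ : Set (EuclideanSpace ℝ (Fin N))), U p = W p := fun p hp =>
    (hUW p hp).antisymm (neg_upperRelaxed_neg_le hfM p)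
  have hlim : ∀ p ∈ Ioc 0 T ×ˢ (univ : Set (EuclideanSpace ℝ (Fin N))),
      Tendsto (fun q : ℝ × (ℝ × EuclideanSpace ℝ (Fin N)) => f q.1 q.2) (𝓝[>] 0 ×ˢ 𝓝 p)
        (𝓝 (U p)) := fun p hp => tendsto_of_upperRelaxed_le hfM (hUW p hp)
  have hUlsc : LowerSemicontinuousOn U (Ioc 0 T ×ˢ univ) := fun z hz y hy => by
    replace hy : y < U z := hy
    rw [heq z hz] at hy
    filter_upwards [hWlsc z hz y hy, self_mem_nhdsWithin] with z' h1 h2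
    exact h1.trans_eq (heq z' h2).symm
  have hUc : ContinuousOn U (Ioc 0 T ×ˢ univ) :=
    continuousOn_iff_lower_upperSemicontinuousOn.mpr ⟨hUlsc, hUusc⟩
  have hstrip : Ioo 0 T ×ˢ (univ : Set (EuclideanSpace ℝ (Fin N))) ⊆ Ioc 0 T ×ˢ univ :=
    prod_mono Ioo_subset_Ioc_self subset_rfl
  -- `U = W` is known only for times in `(0, T]`, but local minima see only the open strip.
  have hUsup : IsViscositySupersolution v T U := by
    refine ⟨hUlsc.mono hstrip, fun φ hφ t x ht hmin => hsup.2 φ hφ t x ht ?_⟩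
    filter_upwards [hmin, strip_mem_nhds ht x] with p h1 h2
    rwa [← heq p (hstrip h2), ← heq (t, x) (hstrip ⟨ht, mem_univ _⟩)]
  refine ⟨U, ⟨hUc, hsub, hUsup, hUT⟩, fun w hw p hp => ?_, ?_⟩
  · refine le_antisymm ?_ ?_
    · exact viscosity_comparison hv hw.subsolution hUsup hw.continuousOn.upperSemicontinuousOn
        hUlsc (fun x => by rw [hw.terminal, hUT]) hp
    · exact viscosity_comparison hv hsub hw.supersolution hUusc
        hw.continuousOn.lowerSemicontinuousOn (fun x => by rw [hw.terminal, hUT]) hp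
  · rw [tendstoLocallyUniformlyOn_iff_forall_tendsto]
    intro p hp
    have h1 : Tendsto (fun q : ℝ × (ℝ × EuclideanSpace ℝ (Fin N)) => U q.2)
        (𝓝[>] 0 ×ˢ 𝓝[Ioc 0 T ×ˢ univ] p) (𝓝 (U p)) := (hUc p hp).tendsto.comp tendsto_snd
    have h2 := (hlim p hp).mono_left
      (prod_mono_right (𝓝[>] (0 : ℝ)) (nhdsWithin_le_nhds (s := Ioc 0 T ×ˢ univ)))
    exact (h1.prodMk_nhds h2).mono_right (nhds_le_uniformity _)
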